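/- **Theorem (orthosymplectic Murnaghan–Nakayama rule).** Let $n\ge 1$ and $m\ge 0$, let $X=(x_1,\dots,x_n)$ and $Y=(y_1,\dots,y_m)$ be commuting indeterminates, and let $\overline X=(x_1^{-1},\dots,x_n^{-1})$. *Notation.* Identify a partition with its Young diagram; $\mu\subset\lambda$ means $\mu_i\le\lambda_i$ for all $i$ (equality allowed), $\lambda'$ is the conjugate of $\lambda$, and $\ell(\lambda)$ is the number of its positive parts. For $\mu\subset\lambda$, write $\lambda/\mu\in \mathrm{BS}(r)$ if the skew diagram $\lambda/\mu$ has $r$ boxes, is connected (through boxes sharing a side) and contains no $2\times2$ block of boxes; then $\mathrm{ht}(\lambda/\mu)$ is one less than its number of nonempty rows. For $\mu\subset\lambda$, the skew Schur polynomial $s_{\lambda/\mu}(Y)$ is $\sum_T\prod_{c}y_{T(c)}$, the product over the boxes $c$ of $\lambda/\mu$ and the sum over all fillings $T$ of $\lambda/\mu$ with entries in $\{1,\dots,m\}$ that increase weakly along rows and strictly down columns. Put $\delta=(n,n-1,\dots,1)$. For a partition $\mu=(\mu_1,\dots,\mu_n)$ of length at most $n$, let $$\mathrm{sp}_\mu(X)=\frac{\det_{1\le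 i,j\le n}\bigl(x_i^{\mu_j+n-j+1}-x_i^{-(\mu_j+n-j+1)}\bigr)}{\det_{1\le i,j\le n}\bigl(x_i^{n-j+1}-x_i^{-(n-j+1)}\bigr)},$$ and let $\mathrm{sp}_\mu(X)=0$ if $\ell(\mu)>n$. For every partition $\lambda$ let $$\mathrm{spo}_\lambda(X/Y)=\sum_{\mu\subset\lambda}\mathrm{sp}_\mu(X)\,s_{\lambda'/\mu'}(Y).$$ For $r\ge1$ let $$P_r(X,\overline X/Y)=\sum_{i=1}^n\bigl(x_i^r+x_i^{-r}\bigr)+(-1)^{r-1}\sum_{j=1}^m y_j^r.$$ Given $r\ge 1$ and a partition $\mu$ of length at most $n$, let $m(\mu)$ be the largest $i\in\{1,\dots,n\}$ with $\mu_i+\delta_i\ge r$, and $m(\mu)=0$ if there is no such $i$. For $m(\mu)<q\le n$, put $k=r-(\mu_q+\delta_q)>0$. If $k=\mu_j+\delta_j$ for some $j\ne q$, then $\mathrm{sp}_{\mu^{(q)}}(X)$ is taken to be $0$ (and the sign attached to it is irrelevant). Otherwise let $\Delta_q$ be the tuple obtained from $\mu+\delta$ by replacing its $q$-th entry by $k$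 and arranging the result in descending order, let $p(q)$ be the position of $k$ in $\Delta_q$, and let $\mu^{(q)}$ be the partition $\Delta_q-\delta$. *Claim.* For every partition $\lambda$ with $\ell(\lambda)\le n$ and every integer $r\ge1$, $$\begin{aligned}P_r(X,\overline X/Y)\,\mathrm{spo}_\lambda(X/Y)={}&\sum_{\eta/\lambda\in \mathrm{BS}(r)}(-1)^{\mathrm{ht}(\eta/\lambda)}\,\mathrm{spo}_\eta(X/Y)+\sum_{\lambda/\xi\in \mathrm{BS}(r)}(-1)^{\mathrm{ht}(\lambda/\xi)}\,\mathrm{spo}_\xi(X/Y)\\&+\sum_{\substack{\mu\subset\lambda\\ \mu_n<r-1}}\Bigl(\sum_{q=m(\mu)+1}^{n}(-1)^{p(q)-q+1}\,\mathrm{sp}_{\mu^{(q)}}(X)\Bigr)s_{\lambda'/\mu'}(Y).\end{aligned}$$ Here the first two sums run over all partitions $\eta$, respectively $\xi$, with the stated property; $\eta$ may have more than $n$ parts. -/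

import Mathlib

namespace OrthosymplecticMN

/-! Partitions are Mathlib's Young diagrams. The part `λ_{i+1}` is `lam.rowLen i` (indices from
`0`), the length `ℓ(λ)` is `lam.colLen 0`, the conjugate `λ'` is `lam.transpose`, `|λ|` is
`lam.card`, and containment `μ ⊂ λ` (equality allowed) is `mu ≤ lam`. -/

/-! ### Skew shapes and border strips -/

/-- The boxes of the skew shape `λ/μ` (used for `mu ≤ lam`). -/
def skewCells (lam mu : YoungDiagram) : Finset (ℕ × ℕ) := lam.cells \ mu.cells

/-- Two boxes (row, column) are adjacent if they share a common side. -/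
def Adjacent (c d : ℕ × ℕ) : Prop :=
  (c.1 = d.1 ∧ (c.2 + 1 = d.2 ∨ d.2 + 1 = c.2)) ∨
  (c.2 = d.2 ∧ (c.1 + 1 = d.1 ∨ d.1 + 1 = c.1))

/-- `λ/μ` is a border strip with `r` boxes: a skew shape with `r` boxes that is connected
and contains no `2 × 2` block of boxes. -/
structure IsBorderStrip (r : ℕ) (lam mu : YoungDiagram) : Prop where
  le : mu ≤ lam
  card_eq : (skewCells lam mu).card = r
  connected : ∀ c ∈ skewCells lam mu, ∀ d ∈ skewCells lam mu,
    Relation.ReflTransGen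
      (fun a b => a ∈ skewCells lam mu ∧ b ∈ skewCells lam mu ∧ Adjacent a b) c d
  no_square : ∀ i j : ℕ, ¬ ((i, j) ∈ skewCells lam mu ∧ (i + 1, j) ∈ skewCells lam mu ∧
    (i, j + 1) ∈ skewCells lam mu ∧ (i + 1, j + 1) ∈ skewCells lam mu)

/-- The height of a (nonempty) border strip: one less than its number of nonempty rows. -/
def height (lam mu : YoungDiagram) : ℕ := ((skewCells lam mu).image Prod.fst).card - 1

theorem finite_card_le (N : ℕ) : {mu : YoungDiagram | mu.card ≤ N}.Finite := by
  refine Set.Finite.of_finite_image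
    (f := YoungDiagram.cells) (Set.Finite.subset
      ((Finset.range N ×ˢ Finset.range N).powerset.finite_toSet) ?_) ?_
  · rintro _ ⟨mu, hmu, rfl⟩
    simp only [Finset.coe_powerset, Set.mem_preimage, Set.mem_powerset_iff, Finset.coe_subset]
    rintro ⟨i, j⟩ hij
    have hsub : Finset.range (i + 1) ×ˢ Finset.range (j + 1) ⊆ mu.cells := by
      rintro ⟨a, b⟩ hab
      simp only [Finset.mem_product, Finset.mem_range] at hab
      exact mu.up_left_mem (by omega) (by omega) hij
    have hcard := Finset.card_le_card hsub
    simp only [Finset.card_product, Finset.card_range] at hcard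
    have h2 : mu.cells.card ≤ N := hmu
    simp only [Finset.mem_product, Finset.mem_range]
    constructor <;> nlinarith
  · intro a _ b _ hab
    exact YoungDiagram.ext hab

theorem finite_subdiagrams (lam : YoungDiagram) : {mu : YoungDiagram | mu ≤ lam}.Finite :=
  (finite_card_le lam.card).subset fun _ h => Finset.card_le_card h

theorem finite_stripAdditions (lam : YoungDiagram) (r : ℕ) :
    {eta : YoungDiagram | IsBorderStrip r eta lam}.Finite :=
  (finite_card_le (r + lam.card)).subset fun eta h => by
    have h1 : eta.cells.card ≤ (eta.cells \ lam.cells).card + lam.cells.card :=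
      Finset.card_le_card_sdiff_add_card
    have h2 : (eta.cells \ lam.cells).card = r := h.card_eq
    rw [h2] at h1
    exact h1

theorem finite_stripRemovals (lam : YoungDiagram) (r : ℕ) :
    {xi : YoungDiagram | IsBorderStrip r lam xi}.Finite :=
  (finite_subdiagrams lam).subset fun _ h => h.le

/-- All partitions `μ ⊂ λ`. -/
noncomputable def subdiagrams (lam : YoungDiagram) : Finset YoungDiagram :=
  (finite_subdiagrams lam).toFinset

/-- All partitions `η` such that `η/λ` is a border strip with `r` boxes. -/
noncomputable def stripAdditions (lam : YoungDiagram) (r : ℕ) : Finset YoungDiagram :=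
  (finite_stripAdditions lam r).toFinset

/-- All partitions `ξ` such that `λ/ξ` is a border strip with `r` boxes. -/
noncomputable def stripRemovals (lam : YoungDiagram) (r : ℕ) : Finset YoungDiagram :=
  (finite_stripRemovals lam r).toFinset

/-! ### Symmetric functions, evaluated at elements of a field -/

section Functions

variable {K : Type*} [Field K] {n m : ℕ}

/-- The supersymmetric power sum `P_r(Z/Y) = ∑ z^r + (-1)^(r-1) ∑ y^r`, for `r ≥ 1`. -/
def superPowerSum {ι κ : Type*} [Fintype ι] [Fintype κ] (r : ℕ) (z : ι → K) (y : κ → K) : K :=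
  ∑ i, z i ^ r + (-1) ^ (r - 1) * ∑ j, y j ^ r

/-- The tableau conditions for a filling of the skew shape `λ/μ`: entries increase weakly along
rows and strictly down columns. -/
def IsSemistandard (lam mu : YoungDiagram) (T : {c // c ∈ skewCells lam mu} → Fin m) : Prop :=
  (∀ c d, c.1.1 = d.1.1 → c.1.2 < d.1.2 → T c ≤ T d) ∧
  (∀ c d, c.1.2 = d.1.2 → c.1.1 < d.1.1 → T c < T d)

open Classical in
/-- The skew Schur polynomial `s_{λ/μ}(Y)`, `Y = (y_1, …, y_m)`, for `mu ≤ lam`: the sum of the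
weights of all semistandard tableaux of shape `λ/μ` with `m` possible entries. -/
noncomputable def skewSchur (y : Fin m → K) (lam mu : YoungDiagram) : K :=
  ∑ T : {c // c ∈ skewCells lam mu} → Fin m with IsSemistandard lam mu T, ∏ c, y (T c)

/-- `δ = (n, n - 1, …, 1)`. -/
def delta (n : ℕ) (j : Fin n) : ℕ := n - j

/-- The alternant `A_α = det (x_i^{α_j} - x_i^{-α_j})`. -/
def alternant (x : Fin n → K) (a : Fin n → ℕ) : K :=
  (Matrix.of fun i j : Fin n => x i ^ a j - (x i)⁻¹ ^ a j).det

/-- The symplectic character indexed by `a = (a_1, …, a_n)`, by the Weyl character formula. -/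
def spTuple (x : Fin n → K) (a : Fin n → ℕ) : K :=
  alternant x (fun j => a j + delta n j) / alternant x (delta n)

/-- The symplectic character `sp_λ(X)`, `X = (x_1, …, x_n)`. It is indexed by partitions with at
most `n` parts; as usual it is zero for longer partitions (which carry no symplectic tableaux). -/
def sp (x : Fin n → K) (lam : YoungDiagram) : K :=
  if lam.colLen 0 ≤ n then spTuple x (fun j => lam.rowLen j) else 0

/-- The orthosymplectic Schur polynomial `spo_λ(X/Y) = ∑_{μ ⊂ λ} sp_μ(X) s_{λ'/μ'}(Y)`. -/
noncomputable def spo (x : Fin n → K) (y : Fin m → K) (lam : YoungDiagram) : K :=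
  ∑ mu ∈ subdiagrams lam, sp x mu * skewSchur y lam.transpose mu.transpose

end Functions

/-! ### The data `m(μ)`, `p(q)` and `μ^{(q)}` -/

section ThirdTerm

variable {n : ℕ}

/-- The tuple `μ + δ`. -/
def shifted (n : ℕ) (mu : YoungDiagram) (j : Fin n) : ℕ := mu.rowLen j + delta n j

/-- `m(μ)`: the largest index `i` in `1, …, n` with `μ_i + δ_i ≥ r`, and `0` if there is none.
The element `i : Fin n` stands for the index `i + 1`. -/
def mIndex (n r : ℕ) (mu : YoungDiagram) : ℕ :=
  (Finset.univ.filter fun i : Fin n => r ≤ shifted n mu i).sup fun i => (i : ℕ) + 1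

/-- The tuple `μ + δ` with its `q`-th entry replaced by `r - (μ_q + δ_q)`
(used when `μ_q + δ_q < r`). -/
def reflected (r : ℕ) (mu : YoungDiagram) (q : Fin n) : Fin n → ℕ :=
  Function.update (shifted n mu) q (r - shifted n mu q)

/-- A permutation of the positions that arranges `reflected r mu q` in descending order. -/
def sortPerm (r : ℕ) (mu : YoungDiagram) (q : Fin n) : Equiv.Perm (Fin n) :=
  Tuple.sort fun j => OrderDual.toDual (reflected r mu q j)

/-- `Δ_q`: the tuple `reflected r mu q` arranged in descending order. -/
def sortedTuple (r : ℕ) (mu : YoungDiagram) (q : Fin n) : Fin n → ℕ :=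
  reflected r mu q ∘ sortPerm r mu q

/-- `p(q)`: the position in `Δ_q` of its entry `r - (μ_q + δ_q)`. -/
def pIndex (r : ℕ) (mu : YoungDiagram) (q : Fin n) : Fin n := (sortPerm r mu q).symm q

/-- `μ^{(q)} = Δ_q - δ`. If the entries of `Δ_q` are distinct and positive, no entry of the
difference is negative. -/
def muQ (r : ℕ) (mu : YoungDiagram) (q : Fin n) (j : Fin n) : ℕ :=
  sortedTuple r mu q j - delta n j

open Classical in
/-- `sp_{μ^{(q)}}(X)`, taken to be zero if `r - (μ_q + δ_q) = μ_j + δ_j` for some `j ≠ q`. -/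
noncomputable def spMuQ {K : Type*} [Field K] (x : Fin n → K) (r : ℕ) (mu : YoungDiagram)
    (q : Fin n) : K :=
  if ∃ j, j ≠ q ∧ r - shifted n mu q = shifted n mu j then 0 else spTuple x (muQ r mu q)

end ThirdTerm

/-! ### The indeterminates -/

/-- The field of rational functions in `x_1, …, x_n, y_1, …, y_m`; it contains the ring of Laurent
polynomials in the `x_i` with polynomial dependence on the `y_j`. -/
abbrev RatFun (n m : ℕ) : Type := FractionRing (MvPolynomial (Fin n ⊕ Fin m) ℤ)

/-- The indeterminates `X = (x_1, …, x_n)`. -/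
noncomputable def X (n m : ℕ) (i : Fin n) : RatFun n m :=
  algebraMap (MvPolynomial (Fin n ⊕ Fin m) ℤ) (RatFun n m) (MvPolynomial.X (Sum.inl i))

/-- The inverses `X̄ = (1/x_1, …, 1/x_n)`. -/
noncomputable def Xbar (n m : ℕ) (i : Fin n) : RatFun n m := (X n m i)⁻¹

/-- The indeterminates `Y = (y_1, …, y_m)`. -/
noncomputable def Y (n m : ℕ) (j : Fin m) : RatFun n m :=
  algebraMap (MvPolynomial (Fin n ⊕ Fin m) ℤ) (RatFun n m) (MvPolynomial.X (Sum.inr j))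

end OrthosymplecticMN

open OrthosymplecticMN

namespace OrthosymplecticMN

/-! ### Row lengths -/

/-! Encode a partition by its beads λ_i + N - i. Adding or removing a border strip with r boxes is
the same as moving one bead up or down by r and sorting again, and the height counts the beads that
are jumped. So, inside any determinant that is alternating in the beads, the signed sum over strips
is the sum over all single-bead shifts: a shift that hits another bead gives two equal columns and
vanishes (`sum_stripAdditions_altDet`, `sum_stripRemovals_altDet`).

This applies to both factors of `spo`. For the symplectic factor, multiply row i of the alternant by
x_i^r + x_i^{-r} and sum over i; the outcome is the sum over columns in which one exponent a is
replaced by a + r or a - r. Exponents a + r give strip additions and a - r ≥ 0 gives strip removals.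
A negative exponent is reflected with a sign, since x^{-k} - x^k is minus the entry of exponent k;
these columns form the third sum of the theorem (`powerSum_mul_sp`).

For the skew Schur factor two commutation rules hold: the signed sum of s_{η/ν} over strips η/λ is
p_r s_{λ/ν} plus the signed sum of s_{λ/ρ} over strips ν/ρ, and the signed sum of s_{ξ/ν} over
strips λ/ξ is that of s_{λ/ρ} over strips ρ/ν. In one variable s_{λ/κ} is the determinant of the
h_{l_j - n_i}(y) in the beads l of λ and n of κ, and both rules come from comparing shifted columns
with shifted rows (`sum_det_updateRow_eq_sum_det_updateCol`). The branching rule `skewSchurExt_succ`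
then adds one variable at a time. Conjugation turns a height h into r - 1 - h, which produces the
sign (-1)^(r-1) in front of the power sum of Y.

Finally, the strips added to or removed from λ on the right-hand side are traded by the commutation
rules for strips at the inner partition, and an exchange of summation moves them onto the symplectic
characters, where `powerSum_mul_sp` applies term by term. -/

theorem le_iff_rowLen {mu lam : YoungDiagram} : mu ≤ lam ↔ ∀ i, mu.rowLen i ≤ lam.rowLen i := by
  constructor
  · intro h i
    by_contra hlt
    push Not at hlt
    have h1 : (i, lam.rowLen i) ∈ mu := YoungDiagram.mem_iff_lt_rowLen.2 hlt
    have h2 : (i, lam.rowLen i) ∈ lam := h h1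
    exact absurd (YoungDiagram.mem_iff_lt_rowLen.1 h2) (lt_irrefl _)
  · rintro h ⟨i, j⟩ hij
    have := YoungDiagram.mem_iff_lt_rowLen.1 ((YoungDiagram.mem_cells _).1 hij)
    exact YoungDiagram.mem_iff_lt_rowLen.2 (this.trans_le (h i))

theorem ext_rowLen {mu lam : YoungDiagram} (h : ∀ i, mu.rowLen i = lam.rowLen i) : mu = lam :=
  le_antisymm (le_iff_rowLen.2 fun i => (h i).le) (le_iff_rowLen.2 fun i => (h i).ge)

theorem mem_skewCells {lam mu : YoungDiagram} {i j : ℕ} :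
    (i, j) ∈ skewCells lam mu ↔ mu.rowLen i ≤ j ∧ j < lam.rowLen i := by
  simp only [skewCells, Finset.mem_sdiff, YoungDiagram.mem_cells,
    YoungDiagram.mem_iff_lt_rowLen, not_lt]
  exact and_comm

theorem colLen_le_iff {lam : YoungDiagram} {N : ℕ} : lam.colLen 0 ≤ N ↔ lam.rowLen N = 0 := by
  have h1 := @YoungDiagram.mem_iff_lt_rowLen lam N 0
  have h2 := @YoungDiagram.mem_iff_lt_colLen lam N 0
  have h3 := h1.symm.trans h2
  omega

theorem rowLen_eq_zero {lam : YoungDiagram} {N i : ℕ} (h : lam.colLen 0 ≤ N) (hi : N ≤ i) :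
    lam.rowLen i = 0 :=
  colLen_le_iff.1 (h.trans hi)

theorem colLen_le_card (lam : YoungDiagram) (j : ℕ) : lam.colLen j ≤ lam.card := by
  rw [YoungDiagram.colLen_eq_card]
  exact Finset.card_le_card (Finset.filter_subset _ _)

/-- The Young diagram with row lengths `f i`, when `f` vanishes from `N` on. -/
def diagramOfRows (f : ℕ → ℕ) (hf : Antitone f) (N : ℕ) : YoungDiagram where
  cells := (Finset.range N ×ˢ Finset.range (f 0)).filter fun c => c.2 < f c.1
  isLowerSet := by
    rintro ⟨i, j⟩ ⟨i', j'⟩ h hc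
    have hi : i' ≤ i := h.1
    have hj : j' ≤ j := h.2
    simp only [Finset.coe_filter, Finset.mem_product, Finset.mem_range, Set.mem_ofPred_eq] at hc ⊢
    have h1 := hf hi
    exact ⟨⟨by omega, by omega⟩, by omega⟩

theorem rowLen_diagramOfRows (f : ℕ → ℕ) (hf : Antitone f) (N : ℕ) (hN : f N = 0) (i : ℕ) :
    (diagramOfRows f hf N).rowLen i = f i := by
  have key : ∀ j, j < (diagramOfRows f hf N).rowLen i ↔ j < f i := by
    intro j
    rw [← YoungDiagram.mem_iff_lt_rowLen, ← YoungDiagram.mem_cells]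
    simp only [diagramOfRows, Finset.mem_filter, Finset.mem_product, Finset.mem_range]
    constructor
    · exact fun h => h.2
    · intro h
      refine ⟨⟨?_, h.trans_le (hf (Nat.zero_le i))⟩, h⟩
      by_contra hi
      have := hf (not_lt.1 hi)
      omega
  have h1 := key (f i)
  have h2 := key ((diagramOfRows f hf N).rowLen i)
  omega

/-! ### Border strips in terms of row lengths -/

/-- `eta/lam` is the border strip with `r` boxes occupying the rows `p, …, q`, described by
row lengths. -/
structure IsMove (r : ℕ) (eta lam : YoungDiagram) (p q : ℕ) : Prop where
  le : p ≤ q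
  above : ∀ i < p, eta.rowLen i = lam.rowLen i
  below : ∀ i > q, eta.rowLen i = lam.rowLen i
  mid : ∀ i, p ≤ i → i < q → eta.rowLen (i + 1) = lam.rowLen i + 1
  top : eta.rowLen p + q = lam.rowLen q + r + p

namespace IsMove

variable {r : ℕ} {eta lam : YoungDiagram} {p q : ℕ}

theorem lt_of_mem (h : IsMove r eta lam p q) (hr : 1 ≤ r) {i : ℕ} (hp : p ≤ i) (hq : i ≤ q) :
    lam.rowLen i < eta.rowLen i := by
  rcases hp.eq_or_lt with rfl | hlt
  · rcases hq.eq_or_lt with rfl | hlt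
    · have := h.top
      omega
    · have h1 := h.mid p le_rfl hlt
      have h2 := eta.rowLen_anti p (p + 1) (by omega)
      omega
  · obtain ⟨k, rfl⟩ : ∃ k, i = k + 1 := ⟨i - 1, by omega⟩
    have h1 := h.mid k (by omega) (by omega)
    have h2 := lam.rowLen_anti k (k + 1) (by omega)
    omega

theorem lt_iff (h : IsMove r eta lam p q) (hr : 1 ≤ r) (i : ℕ) :
    lam.rowLen i < eta.rowLen i ↔ p ≤ i ∧ i ≤ q := by
  constructor
  · intro hlt
    by_contra hn
    rcases lt_or_ge i p with hi | hi
    · exact absurd (h.above i hi) hlt.ne'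
    · exact absurd (h.below i (by omega)) hlt.ne'
  · rintro ⟨h1, h2⟩
    exact h.lt_of_mem hr h1 h2

theorem rows_le (h : IsMove r eta lam p q) (hr : 1 ≤ r) : lam ≤ eta := by
  rw [le_iff_rowLen]
  intro i
  by_cases hi : p ≤ i ∧ i ≤ q
  · exact (h.lt_of_mem hr hi.1 hi.2).le
  · rcases lt_or_ge i p with h1 | h1
    · exact (h.above i h1).ge
    · exact (h.below i (by omega)).ge

end IsMove

/-- With f (i + 1) = g i + 1, consecutive row contributions cancel up to a unit for each row. -/
theorem sum_rows_telescope (f g : ℕ → ℕ) {p q : ℕ} (hpq : p ≤ q)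
    (hle : ∀ i, p ≤ i → i ≤ q → g i ≤ f i) (hmid : ∀ i, p ≤ i → i < q → f (i + 1) = g i + 1) :
    ∑ i ∈ Finset.Icc p q, (f i - g i) + g q + p = f p + q := by
  induction q, hpq using Nat.le_induction with
  | base =>
    have := hle p le_rfl le_rfl
    simp only [Finset.Icc_self, Finset.sum_singleton]
    omega
  | succ q hq ih =>
    have h1 := ih (fun i h1 h2 => hle i h1 (by omega)) (fun i h1 h2 => hmid i h1 (by omega))
    rw [Finset.sum_Icc_succ_top (by omega)]
    have h2 := hle (q + 1) (by omega) le_rfl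
    have h3 := hmid q hq (by omega)
    omega

theorem card_skewCells_of_rows {eta lam : YoungDiagram} {p q : ℕ}
    (h : ∀ i, lam.rowLen i < eta.rowLen i → p ≤ i ∧ i ≤ q) :
    (skewCells eta lam).card = ∑ i ∈ Finset.Icc p q, (eta.rowLen i - lam.rowLen i) := by
  rw [Finset.card_eq_sum_card_fiberwise (f := Prod.fst) (t := Finset.Icc p q)]
  · refine Finset.sum_congr rfl fun i _ => ?_
    rw [← Nat.card_Ico]
    symm
    refine Finset.card_bij (fun j _ => (i, j)) ?_ ?_ ?_
    · intro j hj
      simpa [mem_skewCells] using hj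
    · intro a _ b _ hab
      exact (Prod.ext_iff.1 hab).2
    · rintro ⟨i', j⟩ hj
      obtain ⟨h1, rfl⟩ := Finset.mem_filter.1 hj
      exact ⟨j, Finset.mem_Ico.2 (mem_skewCells.1 h1), rfl⟩
  · rintro ⟨i, j⟩ hij
    have h1 := mem_skewCells.1 (Finset.mem_coe.1 hij)
    have := h i (by omega)
    simp only [Finset.coe_Icc, Set.mem_Icc]
    exact this

theorem IsMove.card_skewCells {r : ℕ} {eta lam : YoungDiagram} {p q : ℕ}
    (h : IsMove r eta lam p q) (hr : 1 ≤ r) : (skewCells eta lam).card = r := by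
  rw [card_skewCells_of_rows fun i hi => (h.lt_iff hr i).1 hi]
  have h1 := sum_rows_telescope eta.rowLen lam.rowLen h.le
    (fun i h1 h2 => (h.lt_of_mem hr h1 h2).le) h.mid
  have h2 := h.top
  omega

/-- Adjacency within a skew shape. -/
def SkewStep (eta lam : YoungDiagram) (a b : ℕ × ℕ) : Prop :=
  a ∈ skewCells eta lam ∧ b ∈ skewCells eta lam ∧ Adjacent a b

theorem SkewStep.symm {eta lam : YoungDiagram} {a b : ℕ × ℕ} (h : SkewStep eta lam a b) :
    SkewStep eta lam b a := by
  obtain ⟨h1, h2, h3⟩ := h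
  refine ⟨h2, h1, ?_⟩
  unfold Adjacent at h3 ⊢
  omega

theorem reflTransGen_skewStep_symm {eta lam : YoungDiagram} {a b : ℕ × ℕ}
    (h : Relation.ReflTransGen (SkewStep eta lam) a b) :
    Relation.ReflTransGen (SkewStep eta lam) b a := by
  induction h with
  | refl => exact .refl
  | tail _ h2 ih => exact .head h2.symm ih

/-- From any box walk left within its row, and step down at the left end; `mid` puts the box below
the left end into the strip. Each step lowers q - i + j, so the walk ends at the lowest leftmost
box. -/
theorem IsMove.connected_bottom {r : ℕ} {eta lam : YoungDiagram} {p q : ℕ}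
    (h : IsMove r eta lam p q) (hr : 1 ≤ r) (k i j : ℕ) (hk : q - i + j ≤ k)
    (hij : (i, j) ∈ skewCells eta lam) :
    Relation.ReflTransGen (SkewStep eta lam) (i, j) (q, lam.rowLen q) := by
  induction k generalizing i j with
  | zero =>
    have h1 := mem_skewCells.1 hij
    have h2 := (h.lt_iff hr i).1 (by omega)
    obtain rfl : i = q := by omega
    obtain rfl : j = lam.rowLen i := by omega
    exact .refl
  | succ k ih =>
    have h1 := mem_skewCells.1 hij
    have h2 := (h.lt_iff hr i).1 (by omega)
    rcases h1.1.eq_or_lt with h3 | h3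
    · rcases h2.2.eq_or_lt with rfl | h4
      · subst h3
        exact .refl
      · have h5 := h.mid i h2.1 h4
        have h6 := lam.rowLen_anti i (i + 1) (by omega)
        have h7 : (i + 1, j) ∈ skewCells eta lam := mem_skewCells.2 ⟨by omega, by omega⟩
        exact .head ⟨hij, h7, Or.inr ⟨rfl, Or.inl rfl⟩⟩ (ih _ _ (by omega) h7)
    · obtain ⟨l, rfl⟩ : ∃ l, j = l + 1 := ⟨j - 1, by omega⟩
      have h7 : (i, l) ∈ skewCells eta lam := mem_skewCells.2 ⟨by omega, by omega⟩
      exact .head ⟨hij, h7, Or.inl ⟨rfl, Or.inr rfl⟩⟩ (ih _ _ (by omega) h7)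

theorem IsMove.isBorderStrip {r : ℕ} {eta lam : YoungDiagram} {p q : ℕ}
    (h : IsMove r eta lam p q) (hr : 1 ≤ r) : IsBorderStrip r eta lam where
  le := h.rows_le hr
  card_eq := h.card_skewCells hr
  connected := by
    rintro ⟨i, j⟩ hc ⟨i', j'⟩ hd
    exact (h.connected_bottom hr _ i j le_rfl hc).trans
      (reflTransGen_skewStep_symm (h.connected_bottom hr _ i' j' le_rfl hd))
  no_square := by
    rintro i j ⟨h1, -, -, h4⟩
    rw [mem_skewCells] at h1 h4
    have h5 := (h.lt_iff hr i).1 (by omega)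
    have h6 := (h.lt_iff hr (i + 1)).1 (by omega)
    have := h.mid i h5.1 (by omega)
    omega

theorem IsMove.height_eq {r : ℕ} {eta lam : YoungDiagram} {p q : ℕ}
    (h : IsMove r eta lam p q) (hr : 1 ≤ r) : height eta lam = q - p := by
  have : (skewCells eta lam).image Prod.fst = Finset.Icc p q := by
    ext i
    rw [Finset.mem_image, Finset.mem_Icc, ← h.lt_iff hr i]
    constructor
    · rintro ⟨⟨i', j⟩, hc, rfl⟩
      have := mem_skewCells.1 hc
      simp only
      omega
    · intro hi
      exact ⟨(i, lam.rowLen i), mem_skewCells.2 ⟨le_rfl, hi⟩, rfl⟩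
  rw [height, this, Nat.card_Icc]
  have := h.le
  omega

/-- A path from row a to row b must take a vertical step from row i to row i + 1, so these two rows
of the strip share a column. Otherwise the path never leaves the rows up to i. -/
theorem IsBorderStrip.rowLen_lt {r : ℕ} {eta lam : YoungDiagram} (h : IsBorderStrip r eta lam)
    {a b i : ℕ} (ha : lam.rowLen a < eta.rowLen a) (hb : lam.rowLen b < eta.rowLen b)
    (hai : a ≤ i) (hib : i < b) : lam.rowLen i < eta.rowLen (i + 1) := by
  by_contra hn
  have hpath := h.connected (a, lam.rowLen a) (mem_skewCells.2 ⟨le_rfl, ha⟩)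
    (b, lam.rowLen b) (mem_skewCells.2 ⟨le_rfl, hb⟩)
  have key : ∀ c, Relation.ReflTransGen (fun a b => a ∈ skewCells eta lam ∧
      b ∈ skewCells eta lam ∧ Adjacent a b) (a, lam.rowLen a) c → c.1 ≤ i := by
    intro c hc
    induction hc with
    | refl => exact hai
    | @tail c d _ hstep ih =>
      obtain ⟨c1, c2⟩ := c
      obtain ⟨d1, d2⟩ := d
      obtain ⟨h1, h2, h3⟩ := hstep
      rw [mem_skewCells] at h1 h2
      simp only [Adjacent] at h3 ih ⊢
      by_contra hlt
      obtain rfl : c1 = i := by omega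
      obtain rfl : d1 = c1 + 1 := by omega
      omega
  exact absurd (key _ hpath) (by simpa using hib)

theorem IsBorderStrip.exists_isMove {r : ℕ} {eta lam : YoungDiagram}
    (h : IsBorderStrip r eta lam) (hr : 1 ≤ r) : ∃ p q, IsMove r eta lam p q := by
  have hle := le_iff_rowLen.1 h.le
  set R := (skewCells eta lam).image Prod.fst with hR
  have hmem : ∀ i, i ∈ R ↔ lam.rowLen i < eta.rowLen i := by
    intro i
    rw [hR, Finset.mem_image]
    constructor
    · rintro ⟨⟨i', j⟩, hc, rfl⟩
      have := mem_skewCells.1 hc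
      simp only
      omega
    · intro hi
      exact ⟨(i, lam.rowLen i), mem_skewCells.2 ⟨le_rfl, hi⟩, rfl⟩
  have hne : R.Nonempty := by
    rw [hR, Finset.image_nonempty, ← Finset.card_pos, h.card_eq]
    exact hr
  have hmin := (hmem _).1 (R.min'_mem hne)
  have hmax := (hmem _).1 (R.max'_mem hne)
  have hrange : ∀ i, lam.rowLen i < eta.rowLen i → R.min' hne ≤ i ∧ i ≤ R.max' hne := fun i hi =>
    ⟨R.min'_le _ ((hmem i).2 hi), R.le_max' _ ((hmem i).2 hi)⟩
  have hmid : ∀ i, R.min' hne ≤ i → i < R.max' hne → eta.rowLen (i + 1) = lam.rowLen i + 1 := by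
    intro i h1 h2
    have h3 := h.rowLen_lt hmin hmax h1 h2
    by_contra hcon
    have h4 := eta.rowLen_anti i (i + 1) (by omega)
    have h5 := lam.rowLen_anti i (i + 1) (by omega)
    -- Connectedness gives an overlap of at least one column; an overlap of two would place a square
    -- with its corner at column `lam.rowLen i`.
    exact h.no_square i (lam.rowLen i) ⟨mem_skewCells.2 ⟨by omega, by omega⟩,
      mem_skewCells.2 ⟨by omega, by omega⟩, mem_skewCells.2 ⟨by omega, by omega⟩,
      mem_skewCells.2 ⟨by omega, by omega⟩⟩
  have hpq : R.min' hne ≤ R.max' hne := R.min'_le _ (R.max'_mem hne)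
  refine ⟨R.min' hne, R.max' hne, hpq, ?_, ?_, hmid, ?_⟩
  · intro i hi
    by_contra hcon
    have := hrange i (lt_of_le_of_ne (hle i) (Ne.symm hcon))
    omega
  · intro i hi
    by_contra hcon
    have := hrange i (lt_of_le_of_ne (hle i) (Ne.symm hcon))
    omega
  · have h1 := sum_rows_telescope eta.rowLen lam.rowLen hpq (fun i _ _ => hle i) hmid
    have h2 := h.card_eq
    rw [card_skewCells_of_rows hrange] at h2
    omega

/-! ### Transposition -/

theorem mem_skewCells_transpose {lam mu : YoungDiagram} {c : ℕ × ℕ} :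
    c ∈ skewCells lam.transpose mu.transpose ↔ c.swap ∈ skewCells lam mu := by
  simp only [skewCells, Finset.mem_sdiff, YoungDiagram.mem_cells, YoungDiagram.mem_transpose]

theorem skewCells_transpose (lam mu : YoungDiagram) :
    skewCells lam.transpose mu.transpose = (skewCells lam mu).image Prod.swap := by
  ext c
  rw [mem_skewCells_transpose, Finset.mem_image]
  exact ⟨fun h => ⟨_, h, Prod.swap_swap c⟩, by rintro ⟨d, hd, rfl⟩; simpa using hd⟩

theorem IsBorderStrip.transpose {r : ℕ} {eta lam : YoungDiagram} (h : IsBorderStrip r eta lam) :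
    IsBorderStrip r eta.transpose lam.transpose where
  le := YoungDiagram.transpose_le_iff.2 h.le
  card_eq := by
    rw [skewCells_transpose, Finset.card_image_of_injective _ Prod.swap_injective, h.card_eq]
  connected := by
    intro c hc d hd
    rw [mem_skewCells_transpose] at hc hd
    have hstep : (fun a b => a ∈ skewCells eta lam ∧ b ∈ skewCells eta lam ∧ Adjacent a b) ≤
        Function.onFun (fun a b => a ∈ skewCells eta.transpose lam.transpose ∧
          b ∈ skewCells eta.transpose lam.transpose ∧ Adjacent a b) Prod.swap := by
      intro a b hab
      obtain ⟨h1, h2, h3⟩ := hab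
      refine ⟨mem_skewCells_transpose.2 (by simpa using h1),
        mem_skewCells_transpose.2 (by simpa using h2), ?_⟩
      unfold Adjacent at h3 ⊢
      simp only [Prod.fst_swap, Prod.snd_swap]
      omega
    simpa [Function.onFun] using
      Relation.ReflTransGen.lift Prod.swap hstep _ _ (h.connected _ hc _ hd)
  no_square := by
    rintro i j ⟨h1, h2, h3, h4⟩
    rw [mem_skewCells_transpose] at h1 h2 h3 h4
    exact h.no_square j i ⟨h1, h3, h2, h4⟩

theorem IsMove.image_snd {r : ℕ} {eta lam : YoungDiagram} {p q : ℕ}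
    (h : IsMove r eta lam p q) (hr : 1 ≤ r) :
    (skewCells eta lam).image Prod.snd = Finset.Ico (lam.rowLen q) (eta.rowLen p) := by
  ext j
  rw [Finset.mem_image, Finset.mem_Ico]
  constructor
  · rintro ⟨⟨i, j⟩, hc, rfl⟩
    have h1 := mem_skewCells.1 hc
    have h2 := (h.lt_iff hr i).1 (by omega)
    have h3 := lam.rowLen_anti i q h2.2
    have h4 := eta.rowLen_anti p i h2.1
    simp only
    omega
  · rintro ⟨h1, h2⟩
    have hex : ∃ i, p ≤ i ∧ lam.rowLen i ≤ j := ⟨q, h.le, h1⟩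
    classical
    have hs := Nat.find_spec hex
    have hmin := fun i (hi : i < Nat.find hex) => Nat.find_min hex hi
    have hq : Nat.find hex ≤ q := Nat.find_min' hex ⟨h.le, h1⟩
    set i := Nat.find hex
    refine ⟨(i, j), mem_skewCells.2 ⟨hs.2, ?_⟩, rfl⟩
    rcases hs.1.eq_or_lt with h3 | h3
    · rwa [← h3]
    · obtain ⟨k, hk⟩ : ∃ k, i = k + 1 := ⟨i - 1, by omega⟩
      have h4 := hmin k (by omega)
      have h5 := h.mid k (by omega) (by omega)
      rw [hk]
      push Not at h4
      have := h4 (by omega)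
      omega

/-- The numbers of nonempty rows and nonempty columns of a border strip add up to r + 1. -/
theorem IsBorderStrip.height_transpose {r : ℕ} {eta lam : YoungDiagram}
    (h : IsBorderStrip r eta lam) (hr : 1 ≤ r) :
    height eta.transpose lam.transpose + height eta lam = r - 1 := by
  obtain ⟨p, q, hm⟩ := h.exists_isMove hr
  have h1 : height eta.transpose lam.transpose = eta.rowLen p - lam.rowLen q - 1 := by
    rw [height, skewCells_transpose, Finset.image_image]
    have : (Prod.fst ∘ Prod.swap : ℕ × ℕ → ℕ) = Prod.snd := rfl
    rw [this, hm.image_snd hr, Nat.card_Ico]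
  rw [h1, hm.height_eq hr]
  have h2 := hm.top
  have h3 := hm.le
  have h4 := hm.lt_of_mem hr h3 le_rfl
  have h5 := eta.rowLen_anti p q h3
  omega

/-! ### Existence and uniqueness of border strips with a prescribed end -/

theorem IsMove.top_row_unique_aux {r : ℕ} {eta eta' lam : YoungDiagram} {p p' q : ℕ}
    (h : IsMove r eta lam p q) (h' : IsMove r eta' lam p' q) : ¬ p < p' := by
  intro hlt
  have hq := h'.le
  have h1 := h.mid (p' - 1) (by omega) (by omega)
  have h2 := eta.rowLen_anti p (p' - 1 + 1) (by omega)
  have h3 := h'.above (p' - 1) (by omega)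
  have h4 := eta'.rowLen_anti (p' - 1) p' (by omega)
  have h5 := h.top
  have h6 := h'.top
  omega

/-- The bottom row names the bead that moves up by r, and this determines the new bead set. -/
theorem IsMove.eq_of_bottom {r : ℕ} {eta eta' lam : YoungDiagram} {p p' q : ℕ}
    (h : IsMove r eta lam p q) (h' : IsMove r eta' lam p' q) : eta = eta' := by
  obtain rfl : p = p' := by
    have := h.top_row_unique_aux h'
    have := h'.top_row_unique_aux h
    omega
  refine ext_rowLen fun i => ?_
  rcases lt_trichotomy i p with hi | rfl | hi
  · rw [h.above i hi, h'.above i hi]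
  · have := h.top
    have := h'.top
    omega
  · rcases lt_or_ge q i with hq | hq
    · rw [h.below i hq, h'.below i hq]
    · obtain ⟨k, rfl⟩ : ∃ k, i = k + 1 := ⟨i - 1, by omega⟩
      rw [h.mid k (by omega) (by omega), h'.mid k (by omega) (by omega)]

theorem IsMove.bottom_row_unique_aux {r : ℕ} {eta lam lam' : YoungDiagram} {p q q' : ℕ}
    (h : IsMove r eta lam p q) (h' : IsMove r eta lam' p q') : ¬ q < q' := by
  intro hlt
  have hp := h.le
  have h1 := h'.mid q (by omega) hlt
  have h2 := lam'.rowLen_anti q q' (by omega)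
  have h3 := h.below (q + 1) (by omega)
  have h4 := lam.rowLen_anti q (q + 1) (by omega)
  have h5 := h.top
  have h6 := h'.top
  omega

theorem IsMove.eq_of_top {r : ℕ} {eta lam lam' : YoungDiagram} {p q q' : ℕ}
    (h : IsMove r eta lam p q) (h' : IsMove r eta lam' p q') : lam = lam' := by
  obtain rfl : q = q' := by
    have := h.bottom_row_unique_aux h'
    have := h'.bottom_row_unique_aux h
    omega
  refine ext_rowLen fun i => ?_
  rcases lt_trichotomy i q with hi | rfl | hi
  · rcases lt_or_ge i p with hp | hp
    · rw [← h.above i hp, ← h'.above i hp]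
    · have := h.mid i hp hi
      have := h'.mid i hp hi
      omega
  · have := h.top
    have := h'.top
    omega
  · rw [← h.below i hi, ← h'.below i hi]

/-- The hypothesis says that bead q, raised by r, meets no other bead. Its new position p is the
first one whose bead is smaller than the raised bead. -/
theorem exists_isMove_of_bottom {r : ℕ} (hr : 1 ≤ r) (lam : YoungDiagram) (q : ℕ)
    (hne : ∀ j < q, lam.rowLen j + q ≠ lam.rowLen q + r + j) :
    ∃ eta p, IsMove r eta lam p q := by
  have hex : ∃ j, lam.rowLen j + q < lam.rowLen q + r + j := ⟨q, by omega⟩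
  classical
  have hs := Nat.find_spec hex
  have hmin := fun i (hi : i < Nat.find hex) => Nat.find_min hex hi
  have hq : Nat.find hex ≤ q := Nat.find_min' hex (by omega)
  set p := Nat.find hex
  let f : ℕ → ℕ := fun i => if i < p then lam.rowLen i else if i = p then
    lam.rowLen q + r + p - q else if i ≤ q then lam.rowLen (i - 1) + 1 else lam.rowLen i
  have hf1 : ∀ i < p, f i = lam.rowLen i := fun i hi => by simp [f, hi]
  have hf2 : f p = lam.rowLen q + r + p - q := by simp [f]
  have hf3 : ∀ i, p ≤ i → i < q → f (i + 1) = lam.rowLen i + 1 := fun i h1 h2 => by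
    simp only [f]
    rw [if_neg (by omega), if_neg (by omega), if_pos (by omega)]
    rfl
  have hf4 : ∀ i > q, f i = lam.rowLen i := fun i hi => by
    simp only [f]
    rw [if_neg (by omega), if_neg (by omega), if_neg (by omega)]
  have hanti : Antitone f := by
    refine antitone_nat_of_succ_le fun i => ?_
    have h0 := lam.rowLen_anti i (i + 1) (by omega)
    rcases lt_or_ge (i + 1) p with h1 | h1
    · rw [hf1 i (by omega), hf1 _ h1]
      exact h0
    rcases h1.eq_or_lt with h1 | h1
    · rw [hf1 i (by omega), ← h1, hf2]
      have h2 := hmin i (by omega)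
      have h3 := hne i (by omega)
      omega
    rcases lt_or_ge q (i + 1) with h2 | h2
    · rw [hf4 _ h2]
      rcases Nat.lt_or_ge q i with h3 | h3
      · rw [hf4 _ h3]
        exact h0
      obtain rfl : i = q := by omega
      rcases (show p ≤ i by omega).eq_or_lt with h4 | h4
      · rw [← h4, hf2]
        rw [← h4] at h0
        omega
      · obtain ⟨k, rfl⟩ : ∃ k, i = k + 1 := ⟨i - 1, by omega⟩
        rw [hf3 k (by omega) (by omega)]
        have := lam.rowLen_anti k (k + 1 + 1) (by omega)
        omega
    · rw [hf3 i (by omega) (by omega)]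
      rcases (show p ≤ i by omega).eq_or_lt with h4 | h4
      · rw [← h4, hf2]
        omega
      · obtain ⟨k, rfl⟩ : ∃ k, i = k + 1 := ⟨i - 1, by omega⟩
        rw [hf3 k (by omega) (by omega)]
        have := lam.rowLen_anti k (k + 1) (by omega)
        omega
  have hzero : f (q + 1 + lam.colLen 0) = 0 := by
    rw [hf4 _ (by omega)]
    exact rowLen_eq_zero le_rfl (by omega)
  refine ⟨diagramOfRows f hanti (q + 1 + lam.colLen 0), p, hq, ?_, ?_, ?_, ?_⟩
  all_goals simp only [rowLen_diagramOfRows f hanti _ hzero]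
  · exact hf1
  · exact hf4
  · exact hf3
  · omega

/-- Here bead p is lowered by r. The index j also runs over the empty rows, so the hypothesis
forbids collisions with their beads, which are all the positions low enough; this keeps the
resulting row lengths nonnegative. -/
theorem exists_isMove_of_top {r : ℕ} (hr : 1 ≤ r) (eta : YoungDiagram) (p : ℕ)
    (hne : ∀ j > p, eta.rowLen j + p + r ≠ eta.rowLen p + j) :
    ∃ lam q, IsMove r eta lam p q := by
  have hex : ∃ j, p ≤ j ∧ eta.rowLen (j + 1) + p + r ≤ eta.rowLen p + j + 1 :=
    ⟨p + r, by omega, by have := eta.rowLen_anti p (p + r + 1) (by omega); omega⟩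
  classical
  have hs := Nat.find_spec hex
  have hmin := fun i (hi : i < Nat.find hex) => Nat.find_min hex hi
  set q := Nat.find hex
  have hpos : ∀ i, p ≤ i → i < q → 1 ≤ eta.rowLen (i + 1) := by
    intro i h1 h2
    by_contra h0
    have h3 := hmin i h2
    have h4 := hne (i + 1) (by omega)
    -- If row i + 1 were empty, the lowered bead would coincide with that of the empty row p + r -
    -- η_p.
    have h5 := hne (p + r - eta.rowLen p) (by omega)
    have h6 := eta.rowLen_anti (i + 1) (p + r - eta.rowLen p) (by omega)
    omega
  have hlow : ∀ i, p ≤ i → i < q → eta.rowLen p + i + 1 < eta.rowLen (i + 1) + p + r := by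
    intro i h1 h2
    have h3 := hmin i h2
    have h4 := hne (i + 1) (by omega)
    omega
  have hq := hne (q + 1) (by omega)
  have hqpos : p + r ≤ eta.rowLen p + q := by omega
  let f : ℕ → ℕ := fun i => if i < p then eta.rowLen i else if i < q then
    eta.rowLen (i + 1) - 1 else if i = q then eta.rowLen p + q - r - p else eta.rowLen i
  have hf1 : ∀ i < p, f i = eta.rowLen i := fun i hi => by simp [f, hi]
  have hf2 : ∀ i, p ≤ i → i < q → f i = eta.rowLen (i + 1) - 1 := fun i h1 h2 => by
    simp only [f]
    rw [if_neg (by omega), if_pos (by omega)]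
  have hf3 : f q = eta.rowLen p + q - r - p := by
    simp only [f]
    simp [hs.1.not_gt]
  have hf4 : ∀ i > q, f i = eta.rowLen i := fun i hi => by
    simp only [f]
    rw [if_neg (by omega), if_neg (by omega), if_neg (by omega)]
  have hanti : Antitone f := by
    refine antitone_nat_of_succ_le fun i => ?_
    have h0 := eta.rowLen_anti i (i + 1) (by omega)
    rcases lt_or_ge (i + 1) p with h1 | h1
    · rw [hf1 i (by omega), hf1 _ h1]
      exact h0
    rcases lt_or_ge i p with h2 | h2
    · rw [hf1 i h2]
      rcases lt_or_ge (i + 1) q with h3 | h3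
      · rw [hf2 _ h1 h3]
        have := eta.rowLen_anti i (i + 1 + 1) (by omega)
        omega
      · obtain h4 : q = i + 1 := by omega
        obtain h5 : p = i + 1 := by omega
        rw [← h4, hf3, h4, h5]
        omega
    rcases lt_or_ge i q with h3 | h3
    · rw [hf2 i h2 h3]
      rcases lt_or_ge (i + 1) q with h4 | h4
      · rw [hf2 _ h1 h4]
        have := eta.rowLen_anti (i + 1) (i + 1 + 1) (by omega)
        omega
      · obtain h4 : q = i + 1 := by omega
        have := hlow i h2 h3
        rw [← h4, hf3, h4]
        rw [h4] at hqpos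
        omega
    rw [hf4 _ (by omega)]
    rcases h3.eq_or_lt with h3 | h3
    · rw [← h3, hf3]
      omega
    · rw [hf4 _ h3]
      exact h0
  have hzero : f (q + 1 + eta.colLen 0) = 0 := by
    rw [hf4 _ (by omega)]
    exact rowLen_eq_zero le_rfl (by omega)
  refine ⟨diagramOfRows f hanti (q + 1 + eta.colLen 0), q, hs.1, ?_, ?_, ?_, ?_⟩
  all_goals simp only [rowLen_diagramOfRows f hanti _ hzero]
  · exact fun i hi => (hf1 i hi).symm
  · exact fun i hi => (hf4 i hi).symm
  · intro i h1 h2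
    have := hpos i h1 h2
    rw [hf2 i h1 h2]
    omega
  · omega

/-! ### Beads -/

/-- The strictly decreasing sequence `λ_i + N - i` (`i = 1, …, N`) of first column hook lengths. -/
def bead (N : ℕ) (lam : YoungDiagram) (i : Fin N) : ℕ := lam.rowLen i + (N - 1 - i)

theorem bead_strictAnti (N : ℕ) (lam : YoungDiagram) : StrictAnti (bead N lam) := by
  intro i j hij
  have h1 := lam.rowLen_anti i j hij.le
  have h2 : (i : ℕ) < j := hij
  have := j.isLt
  simp only [bead]
  omega

theorem IsMove.bead_top {N r : ℕ} {eta lam : YoungDiagram} {p q : Fin (N + 1)}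
    (h : IsMove r eta lam p q) : bead (N + 1) eta p = bead (N + 1) lam q + r := by
  have h1 := h.top
  have h2 := q.isLt
  have h3 := p.isLt
  simp only [bead]
  omega

theorem IsMove.bead_succAbove {N r : ℕ} {eta lam : YoungDiagram} {p q : Fin (N + 1)}
    (h : IsMove r eta lam p q) (j : Fin N) :
    bead (N + 1) eta (p.succAbove j) = bead (N + 1) lam (q.succAbove j) := by
  have h0 := h.le
  have h2 := q.isLt
  have h3 := p.isLt
  have h4 := j.isLt
  simp only [bead]
  rcases lt_or_ge (j : ℕ) p with hp | hp
  · rw [Fin.succAbove_of_castSucc_lt p j (by simpa [Fin.lt_def] using hp),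
      Fin.succAbove_of_castSucc_lt q j (by simp only [Fin.lt_def, Fin.val_castSucc]; omega)]
    simp only [Fin.val_castSucc]
    rw [h.above j hp]
  · rw [Fin.succAbove_of_le_castSucc p j (by simpa [Fin.le_def] using hp)]
    rcases lt_or_ge (j : ℕ) q with hq | hq
    · rw [Fin.succAbove_of_castSucc_lt q j (by simpa [Fin.lt_def] using hq)]
      have := h.mid j hp hq
      simp only [Fin.val_castSucc, Fin.val_succ]
      omega
    · rw [Fin.succAbove_of_le_castSucc q j (by simpa [Fin.le_def] using hq)]
      simp only [Fin.val_succ]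
      rw [h.below (j + 1) (by omega)]

/-! ### Alternating functions -/

section Alternating

variable {R : Type*} [CommRing R]

/-- The generalized alternant `det (g_i (a_j))`. -/
def altDet {N : ℕ} {α : Type*} (g : Fin N → α → R) (a : Fin N → α) : R :=
  (Matrix.of fun i j => g i (a j)).det

theorem altDet_eq_zero {N : ℕ} {α : Type*} (g : Fin N → α → R) {a : Fin N → α} {i j : Fin N}
    (hij : i ≠ j) (h : a i = a j) : altDet g a = 0 :=
  Matrix.det_zero_of_column_eq hij fun k => by simp [h]

theorem altDet_comp {N : ℕ} {α : Type*} (g : Fin N → α → R) (a : Fin N → α)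
    (s : Equiv.Perm (Fin N)) : altDet g (a ∘ s) = ((Equiv.Perm.sign s : ℤ) : R) * altDet g a := by
  rw [altDet, altDet, ← Matrix.det_permute']
  rfl

/-- The cycle carrying position `p` to `q` and preserving the order of the other positions. -/
def moveCycle {N : ℕ} (p q : Fin (N + 1)) : Equiv.Perm (Fin (N + 1)) :=
  p.cycleRange.trans q.cycleRange.symm

theorem moveCycle_self {N : ℕ} (p q : Fin (N + 1)) : moveCycle p q p = q := by
  simp [moveCycle]

theorem moveCycle_succAbove {N : ℕ} (p q : Fin (N + 1)) (j : Fin N) :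
    moveCycle p q (p.succAbove j) = q.succAbove j := by
  simp [moveCycle]

theorem sign_moveCycle {N : ℕ} (p q : Fin (N + 1)) :
    Equiv.Perm.sign (moveCycle p q) = (-1) ^ ((p : ℕ) + q) := by
  simp [moveCycle, Equiv.Perm.sign_trans, pow_add, mul_comm]

/-- Carrying one entry from position q to position p passes it over |p - q| others, which fixes the
sign. -/
theorem altDet_move {N : ℕ} {α : Type*} (g : Fin (N + 1) → α → R) {a b : Fin (N + 1) → α}
    {p q : Fin (N + 1)} (hpq : b p = a q) (h : ∀ j, b (p.succAbove j) = a (q.succAbove j)) :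
    altDet g b = (-1) ^ ((p : ℕ) + q) * altDet g a := by
  have hb : b = a ∘ moveCycle p q := by
    funext i
    rcases Fin.eq_self_or_eq_succAbove p i with rfl | ⟨j, rfl⟩
    · simp [moveCycle_self, hpq]
    · simp [moveCycle_succAbove, h]
  rw [hb, altDet_comp, sign_moveCycle]
  push_cast
  rfl

theorem neg_one_pow_sub_eq_add {p q : ℕ} (h : p ≤ q) :
    (-1 : R) ^ (q - p) = (-1) ^ (p + q) := by
  obtain ⟨k, rfl⟩ := Nat.exists_eq_add_of_le h
  rw [Nat.add_sub_cancel_left, ← add_assoc, pow_add, ← two_mul, pow_mul]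
  simp

theorem IsMove.altDet_add {N r : ℕ} (hr : 1 ≤ r) {eta lam : YoungDiagram} {p q : Fin (N + 1)}
    (h : IsMove r eta lam p q) (g : Fin (N + 1) → ℕ → R) :
    (-1) ^ height eta lam * altDet g (bead (N + 1) eta) =
      altDet g (Function.update (bead (N + 1) lam) q (bead (N + 1) lam q + r)) := by
  rw [altDet_move g (a := Function.update (bead (N + 1) lam) q (bead (N + 1) lam q + r))
    (b := bead (N + 1) eta) (p := p) (q := q) (by rw [h.bead_top]; simp)
    (fun j => by rw [h.bead_succAbove]; simp [Fin.succAbove_ne]), h.height_eq hr,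
    neg_one_pow_sub_eq_add h.le, ← mul_assoc, ← mul_pow]
  simp

theorem IsMove.altDet_sub {N r : ℕ} (hr : 1 ≤ r) {eta lam : YoungDiagram} {p q : Fin (N + 1)}
    (h : IsMove r eta lam p q) (g : Fin (N + 1) → ℕ → R) :
    (-1) ^ height eta lam * altDet g (bead (N + 1) lam) =
      altDet g (Function.update (bead (N + 1) eta) p (bead (N + 1) eta p - r)) := by
  rw [altDet_move g (a := Function.update (bead (N + 1) eta) p (bead (N + 1) eta p - r))
    (b := bead (N + 1) lam) (p := q) (q := p) (by rw [h.bead_top]; simp)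
    (fun j => by rw [← h.bead_succAbove]; simp [Fin.succAbove_ne]), h.height_eq hr,
    neg_one_pow_sub_eq_add h.le, ← mul_assoc, add_comm (q : ℕ), ← mul_pow]
  simp

theorem mem_stripAdditions {lam eta : YoungDiagram} {r : ℕ} :
    eta ∈ stripAdditions lam r ↔ IsBorderStrip r eta lam := by
  simp [stripAdditions]

theorem mem_stripRemovals {lam xi : YoungDiagram} {r : ℕ} :
    xi ∈ stripRemovals lam r ↔ IsBorderStrip r lam xi := by
  simp [stripRemovals]

theorem mem_subdiagrams {lam mu : YoungDiagram} : mu ∈ subdiagrams lam ↔ mu ≤ lam := by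
  simp [subdiagrams]

/-- Strips correspond to the beads q that can be raised by r without a collision, and the sign of
the height is that of the sorting cycle. All other q contribute a determinant with two equal
columns. -/
theorem sum_stripAdditions_altDet {N r : ℕ} (hr : 1 ≤ r) {lam : YoungDiagram}
    (hlam : lam.colLen 0 ≤ N + 1) (g : Fin (N + 1) → ℕ → R) :
    ∑ eta ∈ (stripAdditions lam r).filter (fun eta => eta.colLen 0 ≤ N + 1),
        (-1) ^ height eta lam * altDet g (bead (N + 1) eta) =
      ∑ q, altDet g (Function.update (bead (N + 1) lam) q (bead (N + 1) lam q + r)) := by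
  classical
  let e : YoungDiagram → Fin (N + 1) := fun eta =>
    if h : ∃ q : Fin (N + 1), ∃ p : Fin (N + 1), IsMove r eta lam p q then h.choose else 0
  have he : ∀ eta ∈ (stripAdditions lam r).filter (fun eta => eta.colLen 0 ≤ N + 1),
      ∃ p : Fin (N + 1), IsMove r eta lam p (e eta) := by
    intro eta heta
    rw [Finset.mem_filter, mem_stripAdditions] at heta
    obtain ⟨p, q, h⟩ := heta.1.exists_isMove hr
    have hq : q < N + 1 := by
      by_contra hq
      have h1 := rowLen_eq_zero heta.2 (not_lt.1 hq)
      have h2 := h.lt_of_mem hr h.le le_rfl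
      omega
    have hex : ∃ q : Fin (N + 1), ∃ p : Fin (N + 1), IsMove r eta lam p q :=
      ⟨⟨q, hq⟩, ⟨p, h.le.trans_lt hq⟩, h⟩
    simp only [e, dif_pos hex]
    exact hex.choose_spec
  refine Finset.sum_of_injOn e ?_ (fun _ _ => Finset.mem_coe.2 (Finset.mem_univ _)) ?_ ?_
  · intro a ha b hb hab
    obtain ⟨p, hp⟩ := he a ha
    obtain ⟨p', hp'⟩ := he b hb
    rw [← hab] at hp'
    exact hp.eq_of_bottom hp'
  · intro q _ hq
    by_cases hne : ∀ j < (q : ℕ), lam.rowLen j + q ≠ lam.rowLen q + r + j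
    · exfalso
      obtain ⟨eta, p, h⟩ := exists_isMove_of_bottom hr lam q hne
      have hmem : eta ∈ (stripAdditions lam r).filter (fun eta => eta.colLen 0 ≤ N + 1) := by
        rw [Finset.mem_filter, mem_stripAdditions, colLen_le_iff, h.below _ q.isLt]
        exact ⟨h.isBorderStrip hr, colLen_le_iff.1 hlam⟩
      refine hq ⟨eta, hmem, ?_⟩
      obtain ⟨p', h'⟩ := he eta hmem
      have h1 := (h.lt_iff hr q).2 ⟨h.le, le_rfl⟩
      have h2 := (h'.lt_iff hr q).1 h1
      have h3 := (h'.lt_iff hr (e eta)).2 ⟨h'.le, le_rfl⟩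
      have h4 := (h.lt_iff hr (e eta)).1 h3
      exact Fin.ext (le_antisymm h4.2 h2.2)
    · push Not at hne
      obtain ⟨j, hj, hj'⟩ := hne
      have hjN : j < N + 1 := hj.trans q.isLt
      refine altDet_eq_zero g (i := q) (j := ⟨j, hjN⟩) (fun h => hj.ne' (congrArg Fin.val h)) ?_
      rw [Function.update_self, Function.update_of_ne (fun h => hj.ne (congrArg Fin.val h))]
      have := q.isLt
      simp only [bead]
      omega
  · intro eta heta
    obtain ⟨p, h⟩ := he eta heta
    exact h.altDet_add hr g

/-- The mirror image for lowered beads; only beads of size at least r can be lowered. -/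
theorem sum_stripRemovals_altDet {N r : ℕ} (hr : 1 ≤ r) {lam : YoungDiagram}
    (hlam : lam.colLen 0 ≤ N + 1) (g : Fin (N + 1) → ℕ → R) :
    ∑ xi ∈ stripRemovals lam r, (-1) ^ height lam xi * altDet g (bead (N + 1) xi) =
      ∑ p with r ≤ bead (N + 1) lam p,
        altDet g (Function.update (bead (N + 1) lam) p (bead (N + 1) lam p - r)) := by
  classical
  let e : YoungDiagram → Fin (N + 1) := fun xi =>
    if h : ∃ p : Fin (N + 1), ∃ q : Fin (N + 1), IsMove r lam xi p q then h.choose else 0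
  have he : ∀ xi ∈ stripRemovals lam r, ∃ q : Fin (N + 1), IsMove r lam xi (e xi) q := by
    intro xi hxi
    rw [mem_stripRemovals] at hxi
    obtain ⟨p, q, h⟩ := hxi.exists_isMove hr
    have hq : q < N + 1 := by
      by_contra hq
      have h1 := rowLen_eq_zero hlam (not_lt.1 hq)
      have h2 := h.lt_of_mem hr h.le le_rfl
      omega
    have hex : ∃ p : Fin (N + 1), ∃ q : Fin (N + 1), IsMove r lam xi p q :=
      ⟨⟨p, h.le.trans_lt hq⟩, ⟨q, hq⟩, h⟩
    simp only [e, dif_pos hex]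
    exact hex.choose_spec
  refine Finset.sum_of_injOn e ?_ ?_ ?_ ?_
  · intro a ha b hb hab
    obtain ⟨p, hp⟩ := he a ha
    obtain ⟨p', hp'⟩ := he b hb
    rw [← hab] at hp'
    exact hp.eq_of_top hp'
  · intro xi hxi
    obtain ⟨q, h⟩ := he xi hxi
    simp [h.bead_top]
  · intro p hp hp'
    rw [Finset.mem_filter] at hp
    have hr' := hp.2
    have hpN := p.isLt
    by_cases hne : ∀ j > (p : ℕ), lam.rowLen j + p + r ≠ lam.rowLen p + j
    · exfalso
      obtain ⟨xi, q, h⟩ := exists_isMove_of_top hr lam p hne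
      have hmem : xi ∈ stripRemovals lam r := mem_stripRemovals.2 (h.isBorderStrip hr)
      refine hp' ⟨xi, hmem, ?_⟩
      obtain ⟨q', h'⟩ := he xi hmem
      have h1 := (h.lt_iff hr p).2 ⟨le_rfl, h.le⟩
      have h2 := (h'.lt_iff hr p).1 h1
      have h3 := (h'.lt_iff hr (e xi)).2 ⟨le_rfl, h'.le⟩
      have h4 := (h.lt_iff hr (e xi)).1 h3
      exact Fin.ext (le_antisymm h2.1 h4.1)
    · push Not at hne
      obtain ⟨j, hj, hj'⟩ := hne
      -- A collision with an empty row j ≥ N + 1 would force bead p to be smaller than r.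
      have hjN : j < N + 1 := by
        by_contra hjN
        have := rowLen_eq_zero hlam (not_lt.1 hjN)
        simp only [bead] at hr'
        omega
      refine altDet_eq_zero g (i := p) (j := ⟨j, hjN⟩) (fun h => hj.ne (congrArg Fin.val h)) ?_
      rw [Function.update_self, Function.update_of_ne (fun h => hj.ne' (congrArg Fin.val h))]
      simp only [bead] at hr' ⊢
      omega
  · intro xi hxi
    obtain ⟨q, h⟩ := he xi hxi
    exact h.altDet_sub hr g

end Alternating

/-! ### Horizontal strips and the commutation relations in one variable -/

section OneVariable

variable {R : Type*} [CommRing R]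

theorem IsBorderStrip.card_eq_add {r : ℕ} {eta lam : YoungDiagram}
    (h : IsBorderStrip r eta lam) : eta.card = lam.card + r := by
  have h1 := Finset.card_sdiff_add_card_eq_card h.le
  have h2 : (eta.cells \ lam.cells).card = r := h.card_eq
  change eta.cells.card = lam.cells.card + r
  omega

/-- Both sides are the derivative of the determinant at M in the direction M': in each Leibniz
product one factor at a time is replaced. -/
theorem sum_det_updateRow_eq_sum_det_updateCol {ι : Type*} [Fintype ι] [DecidableEq ι]
    (M M' : Matrix ι ι R) :
    ∑ i, (M.updateRow i (M' i)).det = ∑ j, (M.updateCol j fun i => M' i j).det := by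
  simp only [Matrix.det_apply]
  rw [Finset.sum_comm, Finset.sum_comm (s := Finset.univ (α := ι))]
  refine Finset.sum_congr rfl fun s _ => ?_
  rw [← Finset.smul_sum, ← Finset.smul_sum, ← Equiv.sum_comp s]
  congr 1
  refine Finset.sum_congr rfl fun j _ => Finset.prod_congr rfl fun k _ => ?_
  simp only [Matrix.updateRow_apply, Matrix.updateCol_apply, s.injective.eq_iff]
  split_ifs with h
  · rw [h]
  · rfl

theorem altDet_update {N : ℕ} {α : Type*} (g : Fin N → α → R) (a : Fin N → α) (q : Fin N)
    (v : α) : altDet g (Function.update a q v) =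
      ((Matrix.of fun i j => g i (a j)).updateCol q fun i => g i v).det := by
  rw [altDet]
  congr 1
  ext i j
  rw [Matrix.updateCol_apply, Matrix.of_apply, Function.update_apply]
  split_ifs <;> rfl

theorem altDet_update_transpose {N : ℕ} {α : Type*} (g : Fin N → α → R) (a : Fin N → α)
    (q : Fin N) (v : α) : altDet g (Function.update a q v) =
      ((Matrix.of fun i j => g j (a i)).updateRow q fun i => g i v).det := by
  rw [altDet_update, ← Matrix.det_transpose]
  exact congrArg Matrix.det Matrix.updateRow_transpose.symm

/-- The complete homogeneous function `h_{a-b}(y)` in one variable. -/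
def truncPow (y : R) (a b : ℕ) : R := if b ≤ a then y ^ (a - b) else 0

/-- `lam/kap` is a horizontal strip. -/
def IsHorizontalStrip (lam kap : YoungDiagram) : Prop :=
  kap ≤ lam ∧ ∀ i, lam.rowLen (i + 1) ≤ kap.rowLen i

open Classical in
/-- The one-variable skew Schur polynomial. -/
noncomputable def stripWeight (y : R) (lam kap : YoungDiagram) : R :=
  if IsHorizontalStrip lam kap then y ^ (skewCells lam kap).card else 0

theorem isHorizontalStrip_of_interlacing {N : ℕ} {lam kap : YoungDiagram}
    (hlam : lam.colLen 0 ≤ N)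
    (hkap : kap.colLen 0 ≤ N)
    (h1 : ∀ j, bead N kap j ≤ bead N lam j) (h2 : ∀ i j, i < j → bead N lam j < bead N kap i) :
    IsHorizontalStrip lam kap := by
  constructor
  · rw [le_iff_rowLen]
    intro i
    rcases lt_or_ge i N with hi | hi
    · have := h1 ⟨i, hi⟩
      simp only [bead] at this
      omega
    · rw [rowLen_eq_zero hkap hi]
      exact Nat.zero_le _
  · intro i
    rcases lt_or_ge (i + 1) N with hi | hi
    · have := h2 ⟨i, by omega⟩ ⟨i + 1, hi⟩ (by simp [Fin.lt_def])
      simp only [bead] at this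
      omega
    · rw [rowLen_eq_zero hlam hi]
      exact Nat.zero_le _

theorem card_skewCells_eq_sum_bead {N : ℕ} {lam kap : YoungDiagram}
    (hlam : lam.colLen 0 ≤ N) :
    (skewCells lam kap).card = ∑ i : Fin N, (bead N lam i - bead N kap i) := by
  have h0 := rowLen_eq_zero hlam le_rfl
  rw [card_skewCells_of_rows (p := 0) (q := N), ← Nat.range_succ_eq_Icc_zero,
    Finset.sum_range_succ, h0, Nat.zero_sub, add_zero, Finset.sum_range]
  · refine Finset.sum_congr rfl fun i _ => ?_
    simp only [bead]
    omega
  · intro i hi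
    refine ⟨Nat.zero_le _, ?_⟩
    by_contra hN
    rw [rowLen_eq_zero hlam (by omega : N ≤ i)] at hi
    omega

theorem interlacing_of_isHorizontalStrip {N : ℕ} {lam kap : YoungDiagram}
    (h : IsHorizontalStrip lam kap) : (∀ j, bead N kap j ≤ bead N lam j) ∧
      ∀ i j, i < j → bead N lam j < bead N kap i := by
  constructor
  · intro j
    have := le_iff_rowLen.1 h.1 j
    simp only [bead]
    omega
  · intro i j hij
    have hij' : (i : ℕ) < j := hij
    have h1 := h.2 i
    have h2 := lam.rowLen_anti (i + 1) j (by omega)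
    have := j.isLt
    simp only [bead]
    omega

/-- Let k(j) be the first row with n_i ≤ l_j. If there is none, column j is zero; if k(j) = k(j'),
the two columns are proportional. So a nonzero determinant makes k strictly increasing, hence the
identity, and this is the interlacing. -/
theorem interlacing_of_det_ne_zero {N : ℕ} (y : R) {l n : Fin N → ℕ} (hl : StrictAnti l) (hn : StrictAnti n)
    (h : (Matrix.of fun i j => truncPow y (l j) (n i)).det ≠ 0) :
    (∀ j, n j ≤ l j) ∧ ∀ i j, i < j → l j < n i := by
  have hex : ∀ j, ∃ i, n i ≤ l j ∧ ∀ i' < i, l j < n i' := by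
    intro j
    have hne : (Finset.univ.filter fun i => n i ≤ l j).Nonempty := by
      by_contra hemp
      rw [Finset.not_nonempty_iff_eq_empty, Finset.filter_eq_empty_iff] at hemp
      refine h (Matrix.det_eq_zero_of_column_eq_zero j fun i => ?_)
      rw [Matrix.of_apply, truncPow, if_neg (hemp (Finset.mem_univ i))]
    have hmem := (Finset.mem_filter.1 (Finset.min'_mem _ hne)).2
    refine ⟨Finset.min' _ hne, hmem, fun i' hi' => ?_⟩
    by_contra hle
    have hle' : n i' ≤ l j := not_lt.1 hle
    have hi : i' ∈ Finset.univ.filter fun i => n i ≤ l j :=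
      Finset.mem_filter.2 ⟨Finset.mem_univ _, hle'⟩
    exact absurd (Finset.min'_le _ i' hi) (not_le.2 hi')
  choose k hk1 hk2 using hex
  have hmono : StrictMono k := by
    intro j j' hjj
    by_contra hle
    have hlt := hl hjj
    have heq : k j' = k j := by
      refine le_antisymm (not_lt.1 hle) (not_lt.1 fun hlt' => ?_)
      exact absurd (hk1 j') (not_le.2 (hlt.trans (hk2 j _ hlt')))
    refine h ?_
    have hcol : (Matrix.of fun i j => truncPow y (l j) (n i)) =
        (Matrix.of fun i j => truncPow y (l j) (n i)).updateCol j (y ^ (l j - l j') •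
          fun i => truncPow y (l j') (n i)) := by
      ext i i'
      rw [Matrix.updateCol_apply]
      split_ifs with hi
      · subst hi
        simp only [Matrix.of_apply, Pi.smul_apply, smul_eq_mul, truncPow]
        by_cases hle' : n i ≤ l j'
        · rw [if_pos hle', if_pos (hle'.trans hlt.le), ← pow_add]
          congr 1
          omega
        · rw [if_neg hle', if_neg, mul_zero]
          intro hle''
          have h1 : k i' ≤ i := not_lt.1 fun hi => absurd (hk2 i' i hi) (not_lt.2 hle'')
          rw [← heq] at h1
          exact hle' ((hn.antitone h1).trans (hk1 j'))
      · rfl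
    rw [hcol, Matrix.det_updateCol_smul]
    have hz := Matrix.det_updateCol_eq_zero
      (M := Matrix.of fun i j => truncPow y (l j) (n i)) hjj.ne'
    simp only [Matrix.of_apply] at hz
    rw [hz, mul_zero]
  have hid : k = id := StrictMono.range_inj hmono strictMono_id |>.1 (by
    rw [Set.range_id, (Finite.injective_iff_surjective.1 hmono.injective).range_eq])
  rw [hid] at hk1 hk2
  exact ⟨hk1, fun i j => hk2 j i⟩

/-- The Jacobi–Trudi formula in one variable: for interlacing beads the matrix is lower triangular
with diagonal product y^|λ/κ|. -/
theorem det_truncPow {N : ℕ} (y : R) {lam kap : YoungDiagram} (hlam : lam.colLen 0 ≤ N)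
    (hkap : kap.colLen 0 ≤ N) :
    (Matrix.of fun i j => truncPow y (bead N lam j) (bead N kap i)).det =
      stripWeight y lam kap := by
  rw [stripWeight]
  split_ifs with h
  · obtain ⟨h1, h2⟩ := interlacing_of_isHorizontalStrip (N := N) h
    rw [Matrix.det_of_isLowerTriangular, card_skewCells_eq_sum_bead hlam, ← Finset.prod_pow_eq_pow_sum]
    · refine Finset.prod_congr rfl fun i _ => ?_
      rw [Matrix.of_apply, truncPow, if_pos (h1 i)]
    · intro i j hij
      rw [Matrix.of_apply, truncPow, if_neg (not_le.2 (h2 i j hij))]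
  · by_contra hne
    obtain ⟨h1, h2⟩ := interlacing_of_det_ne_zero y (bead_strictAnti N lam) (bead_strictAnti N kap) hne
    exact h (isHorizontalStrip_of_interlacing hlam hkap h1 h2)

theorem altDet_truncPow {N : ℕ} (y : R) {lam kap : YoungDiagram} (hlam : lam.colLen 0 ≤ N)
    (hkap : kap.colLen 0 ≤ N) :
    altDet (fun i a => truncPow y a (bead N kap i)) (bead N lam) = stripWeight y lam kap :=
  det_truncPow y hlam hkap

theorem altDet_truncPow' {N : ℕ} (y : R) {lam kap : YoungDiagram} (hlam : lam.colLen 0 ≤ N)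
    (hkap : kap.colLen 0 ≤ N) :
    altDet (fun i b => truncPow y (bead N lam i) b) (bead N kap) = stripWeight y lam kap := by
  rw [← det_truncPow y hlam hkap, ← Matrix.det_transpose]
  rfl

/-- Raising l_j by r and lowering n_i by r have the same effect on l_j - n_i, so column shifts for λ
become row shifts for κ. The term with y^r comes from the row of κ whose bead is 0. -/
theorem sum_stripAdditions_stripWeight (y : R) {r : ℕ} (hr : 1 ≤ r) (lam kap : YoungDiagram) :
    ∑ eta ∈ stripAdditions lam r, (-1) ^ height eta lam * stripWeight y eta kap =
      y ^ r * stripWeight y lam kap +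
      ∑ mu ∈ stripRemovals kap r, (-1) ^ height kap mu * stripWeight y lam mu := by
  -- N + 1 rows suffice for every partition that occurs, and κ has at most N parts, so its last bead
  -- is 0.
  obtain ⟨N, hN⟩ : ∃ N, N = lam.card + r + kap.card := ⟨_, rfl⟩
  have hlamN : lam.colLen 0 ≤ N + 1 := (colLen_le_card lam 0).trans (by omega)
  have hkapN : kap.colLen 0 ≤ N := (colLen_le_card kap 0).trans (by omega)
  have hadd : ∀ eta ∈ stripAdditions lam r, eta.colLen 0 ≤ N + 1 := fun eta h =>
    (colLen_le_card eta 0).trans ((mem_stripAdditions.1 h).card_eq_add.le.trans (by omega))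
  have hrem : ∀ mu ∈ stripRemovals kap r, mu.colLen 0 ≤ N + 1 := fun mu h =>
    (colLen_le_card mu 0).trans ((Finset.card_le_card (mem_stripRemovals.1 h).le).trans
      (by change kap.card ≤ _; omega))
  set l := bead (N + 1) lam with hl
  set n := bead (N + 1) kap with hn
  have hlast : n (Fin.last N) = 0 := by
    simp [hn, bead, rowLen_eq_zero hkapN le_rfl]
  have hA := sum_stripAdditions_altDet hr hlamN (fun i a => truncPow y a (n i))
  rw [Finset.filter_true_of_mem hadd] at hA
  simp only [altDet_update, ← hl] at hA
  rw [Finset.sum_congr rfl fun eta h => by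
    rw [← altDet_truncPow y (hadd eta h) (hkapN.trans N.le_succ)], hA]
  have hB := sum_stripRemovals_altDet hr (hkapN.trans N.le_succ) (fun i b => truncPow y (l i) b)
  simp only [altDet_update_transpose, ← hn] at hB
  rw [Finset.sum_congr (s₁ := stripRemovals kap r) rfl fun mu h => by
    rw [← altDet_truncPow' y hlamN (hrem mu h)], hB]
  set M : Matrix (Fin (N + 1)) (Fin (N + 1)) R := Matrix.of fun i j => truncPow y (l j) (n i)
    with hM
  set M' : Matrix (Fin (N + 1)) (Fin (N + 1)) R := Matrix.of fun i j =>
    truncPow y (l j + r) (n i) with hM'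
  have key := sum_det_updateRow_eq_sum_det_updateCol M M'
  refine key.symm.trans ?_
  rw [← Finset.sum_filter_not_add_sum_filter Finset.univ (fun i => r ≤ n i)]
  congr 1
  -- When n_i < r the truncation is void, and the shifted row is a multiple of the last row; it
  -- contributes only if i itself is the last row.
  · have hrow : ∀ i, ¬ r ≤ n i → M' i = y ^ (r - n i) • M (Fin.last N) := by
      intro i hi
      funext j
      simp only [hM, hM', Matrix.of_apply, Pi.smul_apply, smul_eq_mul, truncPow, hlast]
      rw [if_pos (by omega), if_pos (Nat.zero_le _), ← pow_add]
      congr 1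
      omega
    rw [Finset.sum_eq_single (Fin.last N)]
    · rw [hrow _ (by omega), Matrix.det_updateRow_smul, Matrix.updateRow_eq_self, hlast, Nat.sub_zero,
        hM, hl, hn, det_truncPow y hlamN (hkapN.trans N.le_succ)]
    · intro i hi hne
      rw [hrow i (Finset.mem_filter.1 hi).2, Matrix.det_updateRow_smul,
        Matrix.det_updateRow_eq_zero hne.symm, mul_zero]
    · intro hcon
      exact absurd (Finset.mem_filter.2 ⟨Finset.mem_univ _, by omega⟩) hcon
  · refine Finset.sum_congr rfl fun i hi => ?_
    have hi' := (Finset.mem_filter.1 hi).2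
    congr 2
    funext j
    simp only [hM', Matrix.of_apply, truncPow]
    exact if_congr (by omega) (congrArg _ (by omega)) rfl

/-- Now l_j is lowered and n_i is raised. Columns with l_j < r vanish entirely, so there is no extra
term. -/
theorem sum_stripRemovals_stripWeight (y : R) {r : ℕ} (hr : 1 ≤ r) (lam kap : YoungDiagram) :
    ∑ xi ∈ stripRemovals lam r, (-1) ^ height lam xi * stripWeight y xi kap =
      ∑ mu ∈ stripAdditions kap r, (-1) ^ height mu kap * stripWeight y lam mu := by
  obtain ⟨N, hN⟩ : ∃ N, N = lam.card + r + kap.card := ⟨_, rfl⟩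
  have hlamN : lam.colLen 0 ≤ N + 1 := (colLen_le_card lam 0).trans (by omega)
  have hkapN : kap.colLen 0 ≤ N + 1 := (colLen_le_card kap 0).trans (by omega)
  have hadd : ∀ mu ∈ stripAdditions kap r, mu.colLen 0 ≤ N + 1 := fun mu h =>
    (colLen_le_card mu 0).trans ((mem_stripAdditions.1 h).card_eq_add.le.trans (by omega))
  have hrem : ∀ xi ∈ stripRemovals lam r, xi.colLen 0 ≤ N + 1 := fun xi h =>
    (colLen_le_card xi 0).trans ((Finset.card_le_card (mem_stripRemovals.1 h).le).trans
      (by change lam.card ≤ _; omega))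
  set l := bead (N + 1) lam with hl
  set n := bead (N + 1) kap with hn
  have hA := sum_stripAdditions_altDet hr hkapN (fun i b => truncPow y (l i) b)
  rw [Finset.filter_true_of_mem hadd] at hA
  simp only [altDet_update_transpose, ← hn] at hA
  have hB := sum_stripRemovals_altDet hr hlamN (fun i a => truncPow y a (n i))
  simp only [altDet_update, ← hl] at hB
  rw [Finset.sum_congr rfl fun xi h => by
    rw [← altDet_truncPow y (hrem xi h) hkapN], hB]
  rw [Finset.sum_congr (s₁ := stripAdditions kap r) rfl fun mu h => by
    rw [← altDet_truncPow' y hlamN (hadd mu h)], hA]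
  set M : Matrix (Fin (N + 1)) (Fin (N + 1)) R := Matrix.of fun i j => truncPow y (l j) (n i)
    with hM
  set M' : Matrix (Fin (N + 1)) (Fin (N + 1)) R := Matrix.of fun i j =>
    truncPow y (l j) (n i + r) with hM'
  have key := sum_det_updateRow_eq_sum_det_updateCol M M'
  refine Eq.trans ?_ key.symm
  rw [← Finset.sum_filter_add_sum_filter_not Finset.univ (fun j => r ≤ l j) fun j =>
    (M.updateCol j fun i => M' i j).det]
  rw [Finset.sum_eq_zero (s := Finset.univ.filter fun j => ¬ r ≤ l j), add_zero]
  · refine Finset.sum_congr rfl fun j hj => ?_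
    have hj' := (Finset.mem_filter.1 hj).2
    congr 2
    funext i
    simp only [hM', Matrix.of_apply, truncPow]
    exact if_congr (by omega) (congrArg _ (by omega)) rfl
  · intro j hj
    have hj' := (Finset.mem_filter.1 hj).2
    refine Matrix.det_eq_zero_of_column_eq_zero j fun i => ?_
    rw [Matrix.updateCol_self, hM', Matrix.of_apply, truncPow, if_neg (by omega)]

end OneVariable

/-! ### The branching rule for skew Schur polynomials -/

section Branching

/-- The filling by `T` on `kap/nu` and by the largest entry elsewhere. -/
def extendFilling {m : ℕ} {kap nu : YoungDiagram} (T : {c // c ∈ skewCells kap nu} → Fin m)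
    (c : ℕ × ℕ) : Fin (m + 1) :=
  if h : c ∈ skewCells kap nu then (T ⟨c, h⟩).castSucc else Fin.last m

theorem extendFilling_of_mem {m : ℕ} {kap nu : YoungDiagram}
    (T : {c // c ∈ skewCells kap nu} → Fin m) {c : ℕ × ℕ} (h : c ∈ skewCells kap nu) :
    extendFilling T c = (T ⟨c, h⟩).castSucc := dif_pos h

theorem extendFilling_of_notMem {m : ℕ} {kap nu : YoungDiagram}
    (T : {c // c ∈ skewCells kap nu} → Fin m) {c : ℕ × ℕ} (h : c ∉ skewCells kap nu) :
    extendFilling T c = Fin.last m := dif_neg h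

theorem extendFilling_ne_last_iff {m : ℕ} {kap nu : YoungDiagram}
    (T : {c // c ∈ skewCells kap nu} → Fin m) (c : ℕ × ℕ) :
    extendFilling T c ≠ Fin.last m ↔ c ∈ skewCells kap nu := by
  by_cases h : c ∈ skewCells kap nu
  · simp [extendFilling_of_mem T h, h, Fin.castSucc_ne_last]
  · simp [extendFilling_of_notMem T h, h]

theorem mem_skewCells' {lam mu : YoungDiagram} {c : ℕ × ℕ} :
    c ∈ skewCells lam mu ↔ c ∈ lam ∧ c ∉ mu := by
  simp [skewCells]

theorem IsHorizontalStrip.mem_of_mem_below {lam kap : YoungDiagram}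
    (h : IsHorizontalStrip lam kap) {i i' j : ℕ} (hi : i < i') (hc : (i', j) ∈ lam) :
    (i, j) ∈ kap := by
  rw [YoungDiagram.mem_iff_lt_rowLen] at hc ⊢
  exact hc.trans_le ((lam.rowLen_anti (i + 1) i' hi).trans (h.2 i))

theorem isSemistandard_extendFilling {m : ℕ} {lam kap nu : YoungDiagram}
    (hs : IsHorizontalStrip lam kap) {T : {c // c ∈ skewCells kap nu} → Fin m}
    (hT : IsSemistandard kap nu T) :
    IsSemistandard lam nu (fun c => extendFilling T c.1) := by
  constructor
  · rintro ⟨⟨i, j⟩, hc⟩ ⟨⟨i', j'⟩, hd⟩ h1 h2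
    simp only at h1 h2 ⊢
    subst h1
    rw [mem_skewCells'] at hc hd
    by_cases hk : (i, j') ∈ skewCells kap nu
    · have hk' := mem_skewCells'.1 hk
      have hck : (i, j) ∈ skewCells kap nu :=
        mem_skewCells'.2 ⟨kap.up_left_mem le_rfl h2.le hk'.1, hc.2⟩
      rw [extendFilling_of_mem T hk, extendFilling_of_mem T hck, Fin.castSucc_le_castSucc_iff]
      exact hT.1 ⟨_, hck⟩ ⟨_, hk⟩ rfl h2
    · rw [extendFilling_of_notMem T hk]
      exact Fin.le_last _
  · rintro ⟨⟨i, j⟩, hc⟩ ⟨⟨i', j'⟩, hd⟩ h1 h2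
    simp only at h1 h2 ⊢
    subst h1
    rw [mem_skewCells'] at hc hd
    have hck : (i, j) ∈ skewCells kap nu :=
      mem_skewCells'.2 ⟨hs.mem_of_mem_below h2 hd.1, hc.2⟩
    rw [extendFilling_of_mem T hck]
    by_cases hk : (i', j) ∈ skewCells kap nu
    · rw [extendFilling_of_mem T hk, Fin.castSucc_lt_castSucc_iff]
      exact hT.2 ⟨_, hck⟩ ⟨_, hk⟩ rfl h2
    · rw [extendFilling_of_notMem T hk]
      exact Fin.castSucc_lt_last _

/-- Deleting the boxes with the largest entry leaves a diagram because entries increase along rows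
and columns; the deleted boxes form a horizontal strip because the increase down columns is strict.
-/
theorem exists_extendFilling {m : ℕ} {lam nu : YoungDiagram} (h : nu ≤ lam)
    {T : {c // c ∈ skewCells lam nu} → Fin (m + 1)} (hT : IsSemistandard lam nu T) :
    ∃ kap, IsHorizontalStrip lam kap ∧ nu ≤ kap ∧
      ∃ T' : {c // c ∈ skewCells kap nu} → Fin m, IsSemistandard kap nu T' ∧
        (fun c : {c // c ∈ skewCells lam nu} => extendFilling T' c.1) = T := by
  classical
  -- Boxes of ν are kept, since the condition is vacuous for them.
  let kap : YoungDiagram :=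
    { cells := lam.cells.filter fun c => ∀ hc : c ∈ skewCells lam nu, T ⟨c, hc⟩ ≠ Fin.last m
      isLowerSet := by
        rintro ⟨i, j⟩ ⟨i', j'⟩ hle hc
        have hi : i' ≤ i := hle.1
        have hj : j' ≤ j := hle.2
        rw [Finset.mem_coe, Finset.mem_filter, YoungDiagram.mem_cells] at hc ⊢
        refine ⟨lam.up_left_mem hi hj hc.1, fun hc' => ?_⟩
        have hnu := (mem_skewCells'.1 hc').2
        have h2 : (i', j) ∈ skewCells lam nu := mem_skewCells'.2
          ⟨lam.up_left_mem hi le_rfl hc.1, fun hh => hnu (nu.up_left_mem le_rfl hj hh)⟩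
        have h3 : (i, j) ∈ skewCells lam nu := mem_skewCells'.2
          ⟨hc.1, fun hh => hnu (nu.up_left_mem hi hj hh)⟩
        have h4 : T ⟨_, hc'⟩ ≤ T ⟨_, h2⟩ := by
          rcases hj.eq_or_lt with rfl | hj
          · exact le_rfl
          · exact hT.1 ⟨_, hc'⟩ ⟨_, h2⟩ rfl hj
        have h5 : T ⟨_, h2⟩ ≤ T ⟨_, h3⟩ := by
          rcases hi.eq_or_lt with rfl | hi
          · exact le_rfl
          · exact (hT.2 ⟨_, h2⟩ ⟨_, h3⟩ rfl hi).le
        exact ((h4.trans h5).trans_lt (Fin.lt_last_iff_ne_last.2 (hc.2 h3))).ne }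
  have hmem : ∀ c, c ∈ kap ↔ c ∈ lam ∧ ∀ hc : c ∈ skewCells lam nu, T ⟨c, hc⟩ ≠ Fin.last m := by
    intro c
    rw [← YoungDiagram.mem_cells, Finset.mem_filter, YoungDiagram.mem_cells]
  have hkl : kap ≤ lam := fun c hc => ((hmem c).1 hc).1
  have hnk : nu ≤ kap := fun c hc =>
    (hmem c).2 ⟨h hc, fun hc' => absurd hc (mem_skewCells'.1 hc').2⟩
  have hsub : ∀ {c}, c ∈ skewCells kap nu → c ∈ skewCells lam nu := fun hc =>
    mem_skewCells'.2 ⟨hkl (mem_skewCells'.1 hc).1, (mem_skewCells'.1 hc).2⟩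
  have hne : ∀ {c} (hc : c ∈ skewCells kap nu), T ⟨c, hsub hc⟩ ≠ Fin.last m := fun hc =>
    ((hmem _).1 (mem_skewCells'.1 hc).1).2 (hsub hc)
  refine ⟨kap, ⟨hkl, fun i => ?_⟩, hnk, fun c => (T ⟨c.1, hsub c.2⟩).castPred (hne c.2),
    ⟨?_, ?_⟩, ?_⟩
  · by_contra hlt
    push Not at hlt
    have h1 : (i + 1, kap.rowLen i) ∈ lam := YoungDiagram.mem_iff_lt_rowLen.2 hlt
    have h2 : (i, kap.rowLen i) ∈ lam := lam.up_left_mem (Nat.le_succ i) le_rfl h1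
    have h3 : (i, kap.rowLen i) ∉ kap := fun hh =>
      lt_irrefl _ (YoungDiagram.mem_iff_lt_rowLen.1 hh)
    have h4 : (i + 1, kap.rowLen i) ∉ kap := fun hh =>
      h3 (kap.up_left_mem (Nat.le_succ i) le_rfl hh)
    have h5 : (i, kap.rowLen i) ∈ skewCells lam nu := mem_skewCells'.2 ⟨h2, fun hh => h3 (hnk hh)⟩
    have h6 : (i + 1, kap.rowLen i) ∈ skewCells lam nu :=
      mem_skewCells'.2 ⟨h1, fun hh => h4 (hnk hh)⟩
    have h7 : T ⟨_, h5⟩ = Fin.last m := by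
      by_contra hh
      exact h3 ((hmem _).2 ⟨h2, fun _ => hh⟩)
    exact absurd (hT.2 ⟨_, h5⟩ ⟨_, h6⟩ rfl (Nat.lt_succ_self i))
      (not_lt.2 (h7 ▸ Fin.le_last _))
  · intro c d h1 h2
    exact hT.1 ⟨_, hsub c.2⟩ ⟨_, hsub d.2⟩ h1 h2
  · intro c d h1 h2
    exact hT.2 ⟨_, hsub c.2⟩ ⟨_, hsub d.2⟩ h1 h2
  · funext c
    by_cases hc : c.1 ∈ skewCells kap nu
    · rw [extendFilling_of_mem _ hc]
      simp
    · rw [extendFilling_of_notMem _ hc]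
      by_contra hh
      exact hc (mem_skewCells'.2 ⟨(hmem _).2 ⟨(mem_skewCells'.1 c.2).1, fun _ => Ne.symm hh⟩,
        (mem_skewCells'.1 c.2).2⟩)

/-- The intermediate partition is recovered as ν together with the boxes whose entry is not the
largest. -/
theorem eq_of_extendFilling_eq {m : ℕ} {lam kap kap' nu : YoungDiagram} (hk : kap ≤ lam)
    (hk' : kap' ≤ lam) (hn : nu ≤ kap) (hn' : nu ≤ kap')
    {T : {c // c ∈ skewCells kap nu} → Fin m} {T' : {c // c ∈ skewCells kap' nu} → Fin m}
    (h : (fun c : {c // c ∈ skewCells lam nu} => extendFilling T c.1) =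
      fun c => extendFilling T' c.1) :
    (⟨kap, T⟩ : Σ kap : YoungDiagram, {c // c ∈ skewCells kap nu} → Fin m) = ⟨kap', T'⟩ := by
  have h' : ∀ c ∈ skewCells lam nu, extendFilling T c = extendFilling T' c := fun c hc =>
    congrFun h ⟨c, hc⟩
  have hkk : kap = kap' := by
    apply YoungDiagram.ext
    ext c
    rw [YoungDiagram.mem_cells, YoungDiagram.mem_cells]
    by_cases hc : c ∈ nu
    · exact ⟨fun _ => hn' hc, fun _ => hn hc⟩
    · constructor
      · intro hck
        have := (extendFilling_ne_last_iff T c).2 (mem_skewCells'.2 ⟨hck, hc⟩)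
        rw [h' c (mem_skewCells'.2 ⟨hk hck, hc⟩), extendFilling_ne_last_iff] at this
        exact (mem_skewCells'.1 this).1
      · intro hck
        have := (extendFilling_ne_last_iff T' c).2 (mem_skewCells'.2 ⟨hck, hc⟩)
        rw [← h' c (mem_skewCells'.2 ⟨hk' hck, hc⟩), extendFilling_ne_last_iff] at this
        exact (mem_skewCells'.1 this).1
  subst hkk
  congr 1
  funext ⟨c, hc⟩
  have := h' c (mem_skewCells'.2 ⟨hk (mem_skewCells'.1 hc).1, (mem_skewCells'.1 hc).2⟩)
  rw [extendFilling_of_mem T hc, extendFilling_of_mem T' hc] at this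
  exact Fin.castSucc_injective _ this

variable {K : Type*} [Field K]

theorem prod_extendFilling {m : ℕ} (y : Fin (m + 1) → K) {lam kap nu : YoungDiagram}
    (hk : kap ≤ lam) (hn : nu ≤ kap) (T : {c // c ∈ skewCells kap nu} → Fin m) :
    ∏ c : {c // c ∈ skewCells lam nu}, y (extendFilling T c.1) =
      y (Fin.last m) ^ (skewCells lam kap).card * ∏ c, y (T c).castSucc := by
  have hun : skewCells lam nu = skewCells lam kap ∪ skewCells kap nu := by
    ext c
    simp only [Finset.mem_union, mem_skewCells']
    have h1 : c ∈ kap → c ∈ lam := fun h => hk h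
    have h2 : c ∈ nu → c ∈ kap := fun h => hn h
    tauto
  have hdis : Disjoint (skewCells lam kap) (skewCells kap nu) := by
    rw [Finset.disjoint_left]
    intro c hc hc'
    exact (mem_skewCells'.1 hc).2 (mem_skewCells'.1 hc').1
  rw [Finset.prod_coe_sort (skewCells lam nu) fun c => y (extendFilling T c), hun,
    Finset.prod_union hdis, ← Finset.prod_const]
  congr 1
  · refine Finset.prod_congr rfl fun c hc => ?_
    rw [extendFilling_of_notMem T fun hc' => (mem_skewCells'.1 hc).2 (mem_skewCells'.1 hc').1]
  · rw [← Finset.prod_coe_sort]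
    refine Finset.prod_congr rfl fun c _ => ?_
    rw [extendFilling_of_mem T c.2]

open Classical in
/-- The skew Schur polynomial, extended by zero to non-nested pairs. -/
noncomputable def skewSchurExt {m : ℕ} (y : Fin m → K) (lam nu : YoungDiagram) : K :=
  if nu ≤ lam then skewSchur y lam nu else 0

/-- Branching: split each tableau into the boxes with the largest entry, a horizontal strip λ/κ, and
a tableau of shape κ/ν in the other letters. -/
theorem skewSchurExt_succ {m : ℕ} (y : Fin (m + 1) → K) (lam nu : YoungDiagram) :
    skewSchurExt y lam nu = ∑ kap ∈ subdiagrams lam,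
      stripWeight (y (Fin.last m)) lam kap * skewSchurExt (fun j => y j.castSucc) kap nu := by
  classical
  by_cases h : nu ≤ lam
  · have hR : ∀ kap, stripWeight (y (Fin.last m)) lam kap *
        skewSchurExt (fun j => y j.castSucc) kap nu =
        if IsHorizontalStrip lam kap ∧ nu ≤ kap then
          ∑ T : {c // c ∈ skewCells kap nu} → Fin m with IsSemistandard kap nu T,
            y (Fin.last m) ^ (skewCells lam kap).card * ∏ c, y (T c).castSucc else 0 := by
      intro kap
      rw [← Finset.mul_sum, stripWeight, skewSchurExt, skewSchur]
      split_ifs <;> simp_all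
    rw [Finset.sum_congr rfl fun kap _ => hR kap, ← Finset.sum_filter, Finset.sum_sigma',
      skewSchurExt, if_pos h, skewSchur]
    symm
    refine Finset.sum_bij (fun s _ => fun c => extendFilling s.2 c.1) ?_ ?_ ?_ ?_
    · rintro ⟨kap, T⟩ hs
      simp only [Finset.mem_sigma, Finset.mem_filter, Finset.mem_univ, true_and] at hs ⊢
      exact isSemistandard_extendFilling hs.1.2.1 hs.2
    · rintro ⟨kap, T⟩ hs ⟨kap', T'⟩ hs' heq
      simp only [Finset.mem_sigma, Finset.mem_filter, Finset.mem_univ, true_and] at hs hs'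
      exact eq_of_extendFilling_eq hs.1.2.1.1 hs'.1.2.1.1 hs.1.2.2 hs'.1.2.2 heq
    · intro T hT
      obtain ⟨kap, h1, h2, T', h3, h4⟩ := exists_extendFilling h (Finset.mem_filter.1 hT).2
      refine ⟨⟨kap, T'⟩, ?_, h4⟩
      simp only [Finset.mem_sigma, Finset.mem_filter, Finset.mem_univ, true_and]
      exact ⟨⟨mem_subdiagrams.2 h1.1, h1, h2⟩, h3⟩
    · rintro ⟨kap, T⟩ hs
      simp only [Finset.mem_sigma, Finset.mem_filter, Finset.mem_univ, true_and] at hs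
      exact (prod_extendFilling y hs.1.2.1.1 hs.1.2.2 T).symm
  · rw [skewSchurExt, if_neg h]
    symm
    refine Finset.sum_eq_zero fun kap hk => ?_
    rw [skewSchurExt, if_neg fun hn => h (hn.trans (mem_subdiagrams.1 hk)), mul_zero]

theorem skewSchurExt_zero (y : Fin 0 → K) (lam nu : YoungDiagram) :
    skewSchurExt y lam nu = open Classical in if lam = nu then 1 else 0 := by
  classical
  rw [skewSchurExt]
  by_cases h : lam = nu
  · subst h
    have he : IsEmpty {c // c ∈ skewCells lam lam} :=
      ⟨fun c => (mem_skewCells'.1 c.2).2 (mem_skewCells'.1 c.2).1⟩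
    rw [if_pos le_rfl, if_pos rfl, skewSchur, Finset.filter_true_of_mem]
    · simp
    · intro T _
      exact ⟨fun c => he.elim c, fun c => he.elim c⟩
  · rw [if_neg h]
    split_ifs with hle
    · rw [skewSchur]
      have hne : (skewCells lam nu).Nonempty := by
        rw [skewCells, Finset.sdiff_nonempty]
        exact fun hh => h (le_antisymm hh hle)
      obtain ⟨c, hc⟩ := hne
      have : IsEmpty ({c // c ∈ skewCells lam nu} → Fin 0) := ⟨fun T => (T ⟨c, hc⟩).elim0⟩
      rw [Finset.sum_eq_zero]
      exact fun T => this.elim T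
    · rfl

end Branching

/-! ### The Murnaghan–Nakayama rule for skew Schur polynomials -/

section SkewMurnaghanNakayama

/-- All partitions of size at most `M`. -/
noncomputable def smallDiagrams (M : ℕ) : Finset YoungDiagram := (finite_card_le M).toFinset

theorem mem_smallDiagrams {M : ℕ} {lam : YoungDiagram} :
    lam ∈ smallDiagrams M ↔ lam.card ≤ M := by
  simp [smallDiagrams]

open Classical in
/-- The signed indicator of border strips of size `r`. -/
noncomputable def stripSign (R : Type*) [CommRing R] (r : ℕ) (eta lam : YoungDiagram) : R :=
  if IsBorderStrip r eta lam then (-1) ^ height eta lam else 0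

section

variable {R : Type*} [CommRing R]

/-- Replaces an index set that depends on λ by a fixed one, so that double sums can be interchanged.
-/
theorem sum_stripAdditions_eq {lam : YoungDiagram} {r M : ℕ} (h : lam.card + r ≤ M)
    (f : YoungDiagram → R) :
    ∑ eta ∈ stripAdditions lam r, (-1) ^ height eta lam * f eta =
      ∑ eta ∈ smallDiagrams M, stripSign R r eta lam * f eta := by
  classical
  refine Finset.sum_subset_zero_on_sdiff (fun eta he => ?_) (fun eta he => ?_) fun eta he => ?_
  · rw [mem_smallDiagrams, (mem_stripAdditions.1 he).card_eq_add]
    exact h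
  · rw [Finset.mem_sdiff, mem_stripAdditions] at he
    rw [stripSign, if_neg he.2, zero_mul]
  · rw [stripSign, if_pos (mem_stripAdditions.1 he)]

theorem sum_stripRemovals_eq {lam : YoungDiagram} {r M : ℕ} (h : lam.card ≤ M)
    (f : YoungDiagram → R) :
    ∑ xi ∈ stripRemovals lam r, (-1) ^ height lam xi * f xi =
      ∑ xi ∈ smallDiagrams M, stripSign R r lam xi * f xi := by
  classical
  refine Finset.sum_subset_zero_on_sdiff (fun xi he => ?_) (fun xi he => ?_) fun xi he => ?_
  · rw [mem_smallDiagrams]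
    have := (mem_stripRemovals.1 he).card_eq_add
    omega
  · rw [Finset.mem_sdiff, mem_stripRemovals] at he
    rw [stripSign, if_neg he.2, zero_mul]
  · rw [stripSign, if_pos (mem_stripRemovals.1 he)]

theorem sum_subdiagrams_eq {lam : YoungDiagram} {M : ℕ} (h : lam.card ≤ M)
    (f : YoungDiagram → R) (hf : ∀ mu, ¬ mu ≤ lam → f mu = 0) :
    ∑ mu ∈ subdiagrams lam, f mu = ∑ mu ∈ smallDiagrams M, f mu := by
  refine Finset.sum_subset (fun mu hmu => ?_) fun mu _ hmu => hf mu fun hle =>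
    hmu (mem_subdiagrams.2 hle)
  exact mem_smallDiagrams.2 ((Finset.card_le_card (mem_subdiagrams.1 hmu)).trans h)

theorem stripWeight_eq_zero (y : R) {lam kap : YoungDiagram} (h : ¬ kap ≤ lam) :
    stripWeight y lam kap = 0 := by
  rw [stripWeight, if_neg fun hs => h hs.1]

end

variable {K : Type*} [Field K]

theorem skewSchurExt_eq_zero {m : ℕ} (y : Fin m → K) {lam nu : YoungDiagram} (h : ¬ nu ≤ lam) :
    skewSchurExt y lam nu = 0 := by
  rw [skewSchurExt, if_neg h]

theorem skewSchurExt_succ' {m : ℕ} (y : Fin (m + 1) → K) {lam : YoungDiagram}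
    (nu : YoungDiagram) {M : ℕ} (h : lam.card ≤ M) :
    skewSchurExt y lam nu = ∑ kap ∈ smallDiagrams M,
      stripWeight (y (Fin.last m)) lam kap * skewSchurExt (fun j => y j.castSucc) kap nu := by
  rw [skewSchurExt_succ, sum_subdiagrams_eq h]
  intro mu hmu
  rw [stripWeight_eq_zero _ hmu, zero_mul]

/-- Induction on the number of variables: the one-variable rule moves the strip from λ to the
intermediate partition, and the induction hypothesis moves it on to ν. Each variable leaves its y^r
behind. -/
theorem sum_stripAdditions_skewSchurExt {m : ℕ} (y : Fin m → K) {r : ℕ} (hr : 1 ≤ r)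
    (lam nu : YoungDiagram) :
    ∑ eta ∈ stripAdditions lam r, (-1) ^ height eta lam * skewSchurExt y eta nu =
      (∑ j, y j ^ r) * skewSchurExt y lam nu +
      ∑ rho ∈ stripRemovals nu r, (-1) ^ height nu rho * skewSchurExt y lam rho := by
  induction m generalizing lam nu with
  | zero =>
    classical
    rw [sum_stripAdditions_eq (M := lam.card + r + nu.card) (by omega),
      sum_stripRemovals_eq (M := lam.card + r + nu.card) (by omega)]
    rw [Finset.univ_eq_empty, Finset.sum_empty, zero_mul, zero_add]
    simp only [skewSchurExt_zero, mul_ite, mul_one, mul_zero]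
    rw [Finset.sum_ite_eq', Finset.sum_ite_eq, if_pos (mem_smallDiagrams.2 (by omega)),
      if_pos (mem_smallDiagrams.2 (by omega))]
  | succ m ih =>
    set z := y (Fin.last m) with hz
    set y' : Fin m → K := fun j => y j.castSucc with hy'
    obtain ⟨M, hM⟩ : ∃ M, M = lam.card + r + nu.card := ⟨_, rfl⟩
    have hexp : ∀ {kap} (rho : YoungDiagram), kap.card ≤ M → skewSchurExt y kap rho =
        ∑ mu ∈ smallDiagrams M, stripWeight z kap mu * skewSchurExt y' mu rho :=
      fun rho h => skewSchurExt_succ' y rho h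
    calc _ = ∑ eta ∈ stripAdditions lam r, ∑ kap ∈ smallDiagrams M,
          (-1) ^ height eta lam * stripWeight z eta kap * skewSchurExt y' kap nu := by
          refine Finset.sum_congr rfl fun eta he => ?_
          rw [hexp nu (by rw [(mem_stripAdditions.1 he).card_eq_add]; omega), Finset.mul_sum]
          simp only [mul_assoc]
      _ = ∑ kap ∈ smallDiagrams M, (z ^ r * stripWeight z lam kap +
          ∑ mu ∈ smallDiagrams M, stripSign K r kap mu * stripWeight z lam mu) *
            skewSchurExt y' kap nu := by
          rw [Finset.sum_comm]
          refine Finset.sum_congr rfl fun kap hk => ?_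
          rw [← Finset.sum_mul, sum_stripAdditions_stripWeight z hr,
            sum_stripRemovals_eq (mem_smallDiagrams.1 hk)]
      _ = z ^ r * skewSchurExt y lam nu + ∑ mu ∈ smallDiagrams M, stripWeight z lam mu *
          ∑ kap ∈ smallDiagrams M, stripSign K r kap mu * skewSchurExt y' kap nu := by
          rw [hexp nu (by omega), Finset.mul_sum]
          simp only [add_mul, Finset.sum_add_distrib, Finset.mul_sum, Finset.sum_mul, mul_assoc]
          congr 1
          rw [Finset.sum_comm]
          refine Finset.sum_congr rfl fun mu _ => Finset.sum_congr rfl fun kap _ => ?_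
          ring
      _ = z ^ r * skewSchurExt y lam nu + ∑ mu ∈ smallDiagrams M, stripWeight z lam mu *
          ((∑ j, y' j ^ r) * skewSchurExt y' mu nu +
            ∑ rho ∈ stripRemovals nu r, (-1) ^ height nu rho * skewSchurExt y' mu rho) := by
          congr 1
          refine Finset.sum_congr rfl fun mu _ => ?_
          -- The bound M leaves room for adding a strip to μ only when μ ⊂ λ; all other μ have
          -- weight zero.
          by_cases hmu : mu ≤ lam
          · have hc : mu.card ≤ lam.card := Finset.card_le_card hmu
            rw [← ih, ← sum_stripAdditions_eq (by omega)]
          · rw [stripWeight_eq_zero _ hmu, zero_mul, zero_mul]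
      _ = _ := by
          rw [Fin.sum_univ_castSucc, add_mul, hexp nu (by omega : lam.card ≤ M)]
          simp only [mul_add, Finset.sum_add_distrib]
          rw [Finset.sum_congr (s₁ := stripRemovals nu r) rfl fun rho _ => by
            rw [hexp rho (by omega : lam.card ≤ M)]]
          simp only [Finset.mul_sum]
          rw [Finset.sum_comm (s := stripRemovals nu r), ← add_assoc, add_comm (∑ i ∈ _, z ^ r * _)]
          congr 1
          · congr 1
            refine Finset.sum_congr rfl fun mu _ => ?_
            ring
          · refine Finset.sum_congr rfl fun mu _ => Finset.sum_congr rfl fun rho _ => ?_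
            ring

theorem sum_stripRemovals_skewSchurExt {m : ℕ} (y : Fin m → K) {r : ℕ} (hr : 1 ≤ r)
    (lam nu : YoungDiagram) :
    ∑ xi ∈ stripRemovals lam r, (-1) ^ height lam xi * skewSchurExt y xi nu =
      ∑ rho ∈ stripAdditions nu r, (-1) ^ height rho nu * skewSchurExt y lam rho := by
  induction m generalizing lam nu with
  | zero =>
    classical
    rw [sum_stripAdditions_eq (M := lam.card + r + nu.card) (by omega),
      sum_stripRemovals_eq (M := lam.card + r + nu.card) (by omega)]
    simp only [skewSchurExt_zero, mul_ite, mul_one, mul_zero]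
    rw [Finset.sum_ite_eq', Finset.sum_ite_eq, if_pos (mem_smallDiagrams.2 (by omega)),
      if_pos (mem_smallDiagrams.2 (by omega))]
  | succ m ih =>
    set z := y (Fin.last m) with hz
    set y' : Fin m → K := fun j => y j.castSucc with hy'
    obtain ⟨M, hM⟩ : ∃ M, M = lam.card := ⟨_, rfl⟩
    calc _ = ∑ xi ∈ stripRemovals lam r, ∑ kap ∈ smallDiagrams M,
          (-1) ^ height lam xi * stripWeight z xi kap * skewSchurExt y' kap nu := by
          refine Finset.sum_congr rfl fun xi he => ?_
          have := (mem_stripRemovals.1 he).card_eq_add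
          rw [skewSchurExt_succ' y nu (by omega : xi.card ≤ M), Finset.mul_sum]
          simp only [mul_assoc, hz, hy']
      _ = ∑ kap ∈ smallDiagrams M, (∑ mu ∈ smallDiagrams (M + r),
          stripSign K r mu kap * stripWeight z lam mu) * skewSchurExt y' kap nu := by
          rw [Finset.sum_comm]
          refine Finset.sum_congr rfl fun kap hk => ?_
          rw [← Finset.sum_mul, sum_stripRemovals_stripWeight z hr,
            sum_stripAdditions_eq (Nat.add_le_add_right (mem_smallDiagrams.1 hk) r)]
      _ = ∑ mu ∈ smallDiagrams (M + r), stripWeight z lam mu *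
          ∑ kap ∈ smallDiagrams M, stripSign K r mu kap * skewSchurExt y' kap nu := by
          simp only [Finset.mul_sum, Finset.sum_mul]
          rw [Finset.sum_comm]
          refine Finset.sum_congr rfl fun mu _ => Finset.sum_congr rfl fun kap _ => ?_
          ring
      _ = ∑ mu ∈ smallDiagrams (M + r), stripWeight z lam mu *
            ∑ rho ∈ stripAdditions nu r, (-1) ^ height rho nu * skewSchurExt y' mu rho := by
          refine Finset.sum_congr rfl fun mu _ => ?_
          by_cases hmu : mu ≤ lam
          · have hc : mu.card ≤ lam.card := Finset.card_le_card hmu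
            rw [← ih, ← sum_stripRemovals_eq (by omega)]
          · rw [stripWeight_eq_zero _ hmu, zero_mul, zero_mul]
      _ = _ := by
          rw [Finset.sum_congr (s₁ := stripAdditions nu r) rfl fun rho _ => by
            rw [skewSchurExt_succ' y rho (by omega : lam.card ≤ M + r)]]
          simp only [Finset.mul_sum]
          rw [Finset.sum_comm (s := stripAdditions nu r)]
          refine Finset.sum_congr rfl fun mu _ => Finset.sum_congr rfl fun rho _ => ?_
          ring

/-! ### Conjugate partitions -/

theorem neg_one_pow_height_transpose {r : ℕ} (hr : 1 ≤ r) {eta lam : YoungDiagram}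
    (h : IsBorderStrip r eta lam) :
    (-1 : K) ^ height eta.transpose lam.transpose = (-1) ^ (r - 1) * (-1) ^ height eta lam := by
  rw [← h.height_transpose hr, pow_add, mul_assoc, ← mul_pow]
  simp

theorem sum_stripAdditions_transpose {r : ℕ} (hr : 1 ≤ r) (lam : YoungDiagram)
    (f : YoungDiagram → K) :
    ∑ eta ∈ stripAdditions lam.transpose r, (-1) ^ height eta lam.transpose * f eta =
      (-1) ^ (r - 1) *
        ∑ eta ∈ stripAdditions lam r, (-1) ^ height eta lam * f eta.transpose := by
  rw [Finset.mul_sum]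
  refine Finset.sum_bij' (fun eta _ => eta.transpose) (fun eta _ => eta.transpose) ?_ ?_ ?_ ?_ ?_
  · intro eta h
    rw [mem_stripAdditions] at h ⊢
    simpa using h.transpose
  · intro eta h
    rw [mem_stripAdditions] at h ⊢
    exact h.transpose
  · simp
  · simp
  · intro eta h
    rw [mem_stripAdditions] at h
    have h' : IsBorderStrip r eta.transpose lam := by simpa using h.transpose
    have := neg_one_pow_height_transpose (K := K) hr h'
    rw [YoungDiagram.transpose_transpose] at this
    rw [this, YoungDiagram.transpose_transpose, mul_assoc]

theorem sum_stripRemovals_transpose {r : ℕ} (hr : 1 ≤ r) (lam : YoungDiagram)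
    (f : YoungDiagram → K) :
    ∑ xi ∈ stripRemovals lam.transpose r, (-1) ^ height lam.transpose xi * f xi =
      (-1) ^ (r - 1) *
        ∑ xi ∈ stripRemovals lam r, (-1) ^ height lam xi * f xi.transpose := by
  rw [Finset.mul_sum]
  refine Finset.sum_bij' (fun xi _ => xi.transpose) (fun xi _ => xi.transpose) ?_ ?_ ?_ ?_ ?_
  · intro xi h
    rw [mem_stripRemovals] at h ⊢
    simpa using h.transpose
  · intro xi h
    rw [mem_stripRemovals] at h ⊢
    exact h.transpose
  · simp
  · simp
  · intro xi h
    rw [mem_stripRemovals] at h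
    have h' : IsBorderStrip r lam xi.transpose := by simpa using h.transpose
    have := neg_one_pow_height_transpose (K := K) hr h'
    rw [YoungDiagram.transpose_transpose] at this
    rw [this, YoungDiagram.transpose_transpose, mul_assoc]

theorem neg_one_pow_mul_self (k : ℕ) : (-1 : K) ^ k * (-1) ^ k = 1 := by
  rw [← mul_pow]
  simp

/-- Conjugation multiplies both strip sums by (-1)^(r-1). Cancelling this sign transfers it to the
power sum. -/
theorem sum_stripAdditions_conjugate {m : ℕ} (y : Fin m → K) {r : ℕ} (hr : 1 ≤ r)
    (lam nu : YoungDiagram) :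
    ∑ eta ∈ stripAdditions lam r,
        (-1) ^ height eta lam * skewSchurExt y eta.transpose nu.transpose =
      (-1) ^ (r - 1) * (∑ j, y j ^ r) * skewSchurExt y lam.transpose nu.transpose +
      ∑ rho ∈ stripRemovals nu r,
        (-1) ^ height nu rho * skewSchurExt y lam.transpose rho.transpose := by
  have h := sum_stripAdditions_skewSchurExt y hr lam.transpose nu.transpose
  rw [sum_stripAdditions_transpose hr, sum_stripRemovals_transpose hr] at h
  have h' := congrArg (fun t => (-1 : K) ^ (r - 1) * t) h
  simp only [mul_add] at h'
  simp only [← mul_assoc, neg_one_pow_mul_self, one_mul] at h'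
  exact h'

theorem sum_stripRemovals_conjugate {m : ℕ} (y : Fin m → K) {r : ℕ} (hr : 1 ≤ r)
    (lam nu : YoungDiagram) :
    ∑ xi ∈ stripRemovals lam r,
        (-1) ^ height lam xi * skewSchurExt y xi.transpose nu.transpose =
      ∑ rho ∈ stripAdditions nu r,
        (-1) ^ height rho nu * skewSchurExt y lam.transpose rho.transpose := by
  have h := sum_stripRemovals_skewSchurExt y hr lam.transpose nu.transpose
  rw [sum_stripAdditions_transpose hr, sum_stripRemovals_transpose hr] at h
  exact mul_left_cancel₀ (pow_ne_zero _ (neg_ne_zero.2 one_ne_zero)) h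

end SkewMurnaghanNakayama

/-! ### Multiplying a symplectic character by a power sum -/

section Symplectic

/-- Away from q the tuple is already decreasing, so the sorting permutation preserves the order of
all other positions, and such a permutation is determined by where q goes. -/
theorem eq_moveCycle {N : ℕ} {b : Fin (N + 1) → ℕ} {q : Fin (N + 1)}
    (hb : StrictAnti (b ∘ q.succAbove)) {s : Equiv.Perm (Fin (N + 1))} (hs : StrictAnti (b ∘ s)) :
    s = moveCycle (s.symm q) q := by
  set p := s.symm q with hp
  have hsp : s p = q := s.apply_symm_apply q
  have hmono : StrictMono (s ∘ p.succAbove) := by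
    intro i j hij
    have h1 := hs (Fin.strictMono_succAbove p hij)
    have hne : ∀ i, s (p.succAbove i) ≠ q := fun i h =>
      Fin.succAbove_ne p i (s.injective (h.trans hsp.symm))
    obtain ⟨a, ha⟩ := Fin.exists_succAbove_eq (hne i)
    obtain ⟨c, hc⟩ := Fin.exists_succAbove_eq (hne j)
    simp only [Function.comp_apply] at h1 ⊢
    rw [← ha, ← hc] at h1 ⊢
    exact Fin.strictMono_succAbove q (hb.lt_iff_gt.1 h1)
  have hrange : Set.range (s ∘ p.succAbove) = Set.range q.succAbove := by
    rw [Set.range_comp, Fin.range_succAbove, Fin.range_succAbove,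
      Set.image_compl_eq s.bijective, Set.image_singleton, hsp]
  have heq := (StrictMono.range_inj hmono (Fin.strictMono_succAbove q)).1 hrange
  ext1 i
  rcases Fin.eq_self_or_eq_succAbove p i with rfl | ⟨j, rfl⟩
  · rw [moveCycle_self, hsp]
  · rw [moveCycle_succAbove, ← heq]
    rfl

/-- Guarantees that the truncated subtraction in `muQ` is a true one. -/
theorem le_of_strictAnti_of_pos {n : ℕ} {f : Fin n → ℕ} (hf : StrictAnti f) (hpos : ∀ j, 0 < f j)
    (j : Fin n) : n - j ≤ f j := by
  have key : ∀ d : ℕ, ∀ j : Fin n, (j : ℕ) + d + 1 = n → d + 1 ≤ f j := by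
    intro d
    induction d with
    | zero => exact fun j _ => hpos j
    | succ d ih =>
      intro j hj
      have h1 := ih ⟨j + 1, by omega⟩ (by simp only; omega)
      have h2 : f ⟨j + 1, by omega⟩ < f j := hf (by simp [Fin.lt_def])
      omega
  have := key (n - 1 - j) j (by omega)
  omega

theorem shifted_eq_bead {n : ℕ} (mu : YoungDiagram) (j : Fin n) :
    shifted n mu j = bead n mu j + 1 := by
  simp only [shifted, delta, bead]
  omega

theorem shifted_strictAnti (n : ℕ) (mu : YoungDiagram) : StrictAnti (shifted n mu) := by
  intro i j hij
  rw [shifted_eq_bead, shifted_eq_bead]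
  exact Nat.succ_lt_succ (bead_strictAnti n mu hij)

/-- Since μ + δ is strictly decreasing, the indices with entry at least r form an initial segment.
-/
theorem mIndex_lt_iff {n r : ℕ} (mu : YoungDiagram) (q : Fin n) :
    mIndex n r mu < (q : ℕ) + 1 ↔ shifted n mu q < r := by
  rw [mIndex, Finset.sup_lt_iff (by exact Nat.succ_pos _)]
  constructor
  · intro h
    by_contra hq
    exact lt_irrefl _ (h q (Finset.mem_filter.2 ⟨Finset.mem_univ _, not_lt.1 hq⟩))
  · intro h i hi
    have h1 := (Finset.mem_filter.1 hi).2
    have h2 : i < q := (shifted_strictAnti n mu).lt_iff_gt.1 (h.trans_le h1)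
    have h3 : (i : ℕ) < q := h2
    omega

variable {K : Type*} [Field K]

/-- The entries `x_i^a - x_i^{-a}` of the symplectic alternants. -/
def spEntry {n : ℕ} (x : Fin n → K) (i : Fin n) (a : ℕ) : K := x i ^ a - (x i)⁻¹ ^ a

theorem alternant_eq_altDet {n : ℕ} (x : Fin n → K) (a : Fin n → ℕ) :
    alternant x a = altDet (spEntry x) a := rfl

theorem altDet_spEntry_succ {n : ℕ} (x : Fin n → K) (a : Fin n → ℕ) :
    altDet (fun i b => spEntry x i (b + 1)) a = alternant x fun j => a j + 1 := rfl

theorem sp_eq {n : ℕ} (x : Fin n → K) {mu : YoungDiagram} (h : mu.colLen 0 ≤ n) :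
    sp x mu = altDet (fun i b => spEntry x i (b + 1)) (bead n mu) / alternant x (delta n) := by
  rw [sp, if_pos h, spTuple, altDet_spEntry_succ]
  congr 2
  funext j
  exact shifted_eq_bead mu j

/-- Sorting the reflected tuple costs the sign of a cycle from q to p(q); the remaining -1 comes
from the reflection. A repeated entry kills the alternant, in accordance with the convention for
`spMuQ`. Counting positions from 0 does not change p(q) - q. -/
theorem alternant_reflected {N r : ℕ} (x : Fin (N + 1) → K) (mu : YoungDiagram)
    {q : Fin (N + 1)} (hq : shifted (N + 1) mu q < r) :
    -alternant x (reflected r mu q) / alternant x (delta (N + 1)) =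
      (-1) ^ ((pIndex r mu q : ℤ) - (q : ℤ) + 1) * spMuQ x r mu q := by
  rw [spMuQ]
  split_ifs with hcol
  · obtain ⟨j, hj, h⟩ := hcol
    rw [alternant_eq_altDet, altDet_eq_zero (spEntry x) (i := q) (j := j) hj.symm (by
      rw [reflected, Function.update_self, Function.update_of_ne hj, h])]
    simp
  · have hinj : Function.Injective (reflected r mu q) := by
      have hne : ∀ j, j ≠ q → reflected r mu q j ≠ reflected r mu q q := by
        intro j hj h
        rw [reflected, Function.update_self, Function.update_of_ne hj] at h
        exact hcol ⟨j, hj, h.symm⟩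
      intro i j hij
      by_cases hi : i = q
      · subst hi
        by_contra hj
        exact hne j (Ne.symm hj) hij.symm
      · by_cases hj : j = q
        · subst hj
          exact absurd hij (hne i hi)
        · rw [reflected, Function.update_of_ne hi, Function.update_of_ne hj] at hij
          exact (shifted_strictAnti _ mu).injective hij
    have hsorted : StrictAnti (reflected r mu q ∘ sortPerm r mu q) := by
      have h1 : Antitone (reflected r mu q ∘ sortPerm r mu q) := fun i j hij =>
        Tuple.monotone_sort (fun j => OrderDual.toDual (reflected r mu q j)) hij
      exact h1.strictAnti_of_injective (hinj.comp (sortPerm r mu q).injective)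
    have hb : StrictAnti (reflected r mu q ∘ q.succAbove) := by
      intro i j hij
      simp only [Function.comp_apply, reflected,
        Function.update_of_ne (Fin.succAbove_ne q _)]
      exact shifted_strictAnti _ mu (Fin.strictMono_succAbove q hij)
    have hpos : ∀ j, 0 < (reflected r mu q ∘ sortPerm r mu q) j := by
      intro j
      rw [Function.comp_apply, reflected, Function.update_apply]
      split_ifs
      · omega
      · rw [shifted_eq_bead]
        omega
    have hsign : ((Equiv.Perm.sign (sortPerm r mu q) : ℤ) : K) =
        (-1) ^ ((pIndex r mu q : ℕ) + q) := by
      rw [eq_moveCycle hb hsorted, sign_moveCycle]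
      push_cast
      rfl
    have hmu : (fun j => muQ r mu q j + delta (N + 1) j) =
        reflected r mu q ∘ sortPerm r mu q := by
      funext j
      rw [muQ]
      exact Nat.sub_add_cancel (le_of_strictAnti_of_pos hsorted hpos j)
    rw [spTuple, hmu, alternant_eq_altDet, alternant_eq_altDet x (_ ∘ _), altDet_comp, hsign,
      zpow_add₀ (neg_ne_zero.2 one_ne_zero), zpow_sub₀ (neg_ne_zero.2 one_ne_zero), zpow_natCast,
      zpow_natCast, zpow_one, pow_add]
    rcases neg_one_pow_eq_or K (pIndex r mu q : ℕ) with h1 | h1 <;>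
      rcases neg_one_pow_eq_or K (q : ℕ) with h2 | h2 <;> rw [h1, h2] <;> ring

theorem spEntry_mul {n : ℕ} {x : Fin n → K} {i : Fin n} (hx : x i ≠ 0) (r a : ℕ) :
    (x i ^ r + (x i)⁻¹ ^ r) * spEntry x i a = spEntry x i (a + r) +
      if r ≤ a then spEntry x i (a - r) else -spEntry x i (r - a) := by
  have hxx : ∀ k, x i ^ k * (x i)⁻¹ ^ k = 1 := fun k => by
    rw [← mul_pow, mul_inv_cancel₀ hx, one_pow]
  split_ifs with h
  · obtain ⟨k, rfl⟩ := Nat.exists_eq_add_of_le h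
    rw [Nat.add_sub_cancel_left]
    simp only [spEntry, pow_add]
    linear_combination (x i ^ k - (x i)⁻¹ ^ k) * hxx r
  · obtain ⟨k, rfl⟩ := Nat.exists_eq_add_of_le (not_le.1 h).le
    rw [Nat.add_sub_cancel_left]
    simp only [spEntry, pow_add]
    linear_combination ((x i)⁻¹ ^ k - x i ^ k) * hxx a

/-- The power sum acts on the alternant as a derivation: scaling row i by x_i^r + x_i^{-r} and
summing over i equals summing the corresponding changes of single columns. -/
theorem powerSum_mul_alternant {n : ℕ} {x : Fin n → K} (hx : ∀ i, x i ≠ 0) (r : ℕ)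
    (a : Fin n → ℕ) :
    (∑ i, (x i ^ r + (x i)⁻¹ ^ r)) * alternant x a =
      ∑ q, alternant x (Function.update a q (a q + r)) +
      (∑ q with r ≤ a q, alternant x (Function.update a q (a q - r)) +
      ∑ q with ¬ r ≤ a q, -alternant x (Function.update a q (r - a q))) := by
  set M : Matrix (Fin n) (Fin n) K := Matrix.of fun i j => spEntry x i (a j) with hM
  have hupd : ∀ q v, alternant x (Function.update a q v) =
      (M.updateCol q fun i => spEntry x i v).det := fun q v => altDet_update (spEntry x) a q v
  have key := sum_det_updateRow_eq_sum_det_updateCol M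
    (fun i j => (x i ^ r + (x i)⁻¹ ^ r) * M i j)
  have hrow : ∀ i, (M.updateRow i fun j => (x i ^ r + (x i)⁻¹ ^ r) * M i j).det =
      (x i ^ r + (x i)⁻¹ ^ r) * alternant x a := by
    intro i
    have h := Matrix.det_updateRow_smul M i (x i ^ r + (x i)⁻¹ ^ r) (M i)
    rw [Matrix.updateRow_eq_self] at h
    exact h
  rw [Finset.sum_congr rfl fun i _ => hrow i, ← Finset.sum_mul] at key
  rw [key, Finset.sum_filter, Finset.sum_filter, ← Finset.sum_add_distrib,
    ← Finset.sum_add_distrib]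
  refine Finset.sum_congr rfl fun q _ => ?_
  have hcol : (fun i => (x i ^ r + (x i)⁻¹ ^ r) * M i q) = (fun i => spEntry x i (a q + r)) +
      fun i => if r ≤ a q then spEntry x i (a q - r) else -spEntry x i (r - a q) := by
    funext i
    exact spEntry_mul (hx i) r (a q)
  rw [hcol, Matrix.det_updateCol_add, hupd, hupd, hupd]
  congr 1
  by_cases h : r ≤ a q
  · simp only [h, if_true, not_true_eq_false, if_false, add_zero]
  · simp only [h, if_false, not_false_eq_true, if_true, zero_add]
    have h2 := Matrix.det_updateCol_smul M q (-1 : K) fun i => spEntry x i (r - a q)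
    rw [neg_one_mul] at h2
    rw [← h2]
    congr 2
    funext i
    simp

/-- The Murnaghan–Nakayama rule for symplectic characters. -/
theorem powerSum_mul_sp {N r : ℕ} (hr : 1 ≤ r) {x : Fin (N + 1) → K} (hx : ∀ i, x i ≠ 0)
    {mu : YoungDiagram} (hmu : mu.colLen 0 ≤ N + 1) :
    (∑ i, (x i ^ r + (x i)⁻¹ ^ r)) * sp x mu =
      ∑ eta ∈ stripAdditions mu r, (-1) ^ height eta mu * sp x eta +
      ∑ xi ∈ stripRemovals mu r, (-1) ^ height mu xi * sp x xi +
      ∑ q with mIndex (N + 1) r mu < (q : Fin (N + 1)).val + 1,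
        (-1) ^ ((pIndex r mu q : ℤ) - (q : ℤ) + 1) * spMuQ x r mu q := by
  have hadd : ∑ eta ∈ stripAdditions mu r, (-1) ^ height eta mu * sp x eta =
      (∑ q, alternant x (Function.update (shifted (N + 1) mu) q (shifted (N + 1) mu q + r))) /
        alternant x (delta (N + 1)) := by
    -- Partitions with more than N + 1 parts drop out, as their symplectic character is zero.
    rw [← Finset.sum_filter_of_ne (p := fun eta : YoungDiagram => eta.colLen 0 ≤ N + 1)
      (fun eta _ h => by
        by_contra hlen
        rw [sp, if_neg hlen, mul_zero] at h
        exact h rfl)]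
    rw [Finset.sum_congr rfl fun eta h => by
      rw [sp_eq x (Finset.mem_filter.1 h).2, ← mul_div_assoc]]
    rw [← Finset.sum_div, sum_stripAdditions_altDet hr hmu]
    congr 1
    refine Finset.sum_congr rfl fun q _ => ?_
    rw [altDet_spEntry_succ]
    congr 1
    funext j
    by_cases hj : j = q
    · subst hj
      simp only [Function.update_self, shifted_eq_bead]
      omega
    · simp only [Function.update_of_ne hj, shifted_eq_bead]
  have hrem : ∑ xi ∈ stripRemovals mu r, (-1) ^ height mu xi * sp x xi =
      (∑ q with r ≤ shifted (N + 1) mu q,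
        alternant x (Function.update (shifted (N + 1) mu) q (shifted (N + 1) mu q - r))) /
        alternant x (delta (N + 1)) := by
    rw [Finset.sum_congr rfl fun xi h => by
      rw [sp_eq x ((colLen_le_iff.2 (Nat.le_zero.1 ((le_iff_rowLen.1
        (mem_stripRemovals.1 h).le (N + 1)).trans (colLen_le_iff.1 hmu).le)))), ← mul_div_assoc]]
    rw [← Finset.sum_div, sum_stripRemovals_altDet hr hmu]
    congr 1
    -- The entries of μ + δ exceed the beads by one. The only extra index has entry exactly r, whose
    -- column becomes x^0 - x^0 = 0.
    refine Finset.sum_subset_zero_on_sdiff (fun q hq => ?_) (fun q hq => ?_) fun q hq => ?_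
    · simp only [Finset.mem_filter, Finset.mem_univ, true_and, shifted_eq_bead] at hq ⊢
      omega
    · simp only [Finset.mem_sdiff, Finset.mem_filter, Finset.mem_univ, true_and,
        shifted_eq_bead] at hq
      refine Matrix.det_eq_zero_of_column_eq_zero q fun i => ?_
      have h0 : bead (N + 1) mu q + 1 - r = 0 := by omega
      simp [shifted_eq_bead, h0]
    · rw [altDet_spEntry_succ]
      have hq' := (Finset.mem_filter.1 hq).2
      congr 1
      funext j
      by_cases hj : j = q
      · subst hj
        simp only [Function.update_self, shifted_eq_bead]
        omega
      · simp only [Function.update_of_ne hj, shifted_eq_bead]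
  have hthird : ∑ q with mIndex (N + 1) r mu < (q : Fin (N + 1)).val + 1,
        (-1) ^ ((pIndex r mu q : ℤ) - (q : ℤ) + 1) * spMuQ x r mu q =
      (∑ q with ¬ r ≤ shifted (N + 1) mu q,
        -alternant x (Function.update (shifted (N + 1) mu) q (r - shifted (N + 1) mu q))) /
        alternant x (delta (N + 1)) := by
    rw [Finset.sum_div]
    refine Finset.sum_congr (Finset.filter_congr fun q _ => ?_) fun q hq => ?_
    · rw [mIndex_lt_iff, not_le]
    · exact (alternant_reflected x mu (not_le.1 (Finset.mem_filter.1 hq).2)).symm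
  have hsp : sp x mu = alternant x (shifted (N + 1) mu) / alternant x (delta (N + 1)) := by
    rw [sp, if_pos hmu]
    rfl
  rw [hadd, hrem, hthird, hsp, ← mul_div_assoc, powerSum_mul_alternant hx, add_div, add_div,
    add_assoc]

end Symplectic

/-! ### Assembling the orthosymplectic rule -/

section Orthosymplectic

variable {K : Type*} [Field K] {n m : ℕ}

theorem spo_eq_sum_smallDiagrams (x : Fin n → K) (y : Fin m → K) {lam : YoungDiagram} {M : ℕ}
    (h : lam.card ≤ M) :
    spo x y lam = ∑ nu ∈ smallDiagrams M,
      sp x nu * skewSchurExt y lam.transpose nu.transpose := by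
  rw [spo, ← sum_subdiagrams_eq h]
  · refine Finset.sum_congr rfl fun mu hmu => ?_
    rw [skewSchurExt, if_pos (YoungDiagram.transpose_le_iff.2 (mem_subdiagrams.1 hmu))]
  · intro mu hmu
    rw [skewSchurExt_eq_zero _ fun hh => hmu (YoungDiagram.transpose_le_iff.1 hh), mul_zero]

/-- Expand `spo` and apply the first commutation rule to each skew factor: the strip passes from the
outer partition λ to the inner partition ν, and the power sum of Y splits off. -/
theorem sum_stripAdditions_spo (x : Fin n → K) (y : Fin m → K) {r : ℕ} (hr : 1 ≤ r)
    {lam : YoungDiagram} {M : ℕ} (h : lam.card + r ≤ M) :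
    ∑ eta ∈ stripAdditions lam r, (-1) ^ height eta lam * spo x y eta =
      (-1) ^ (r - 1) * (∑ j, y j ^ r) * spo x y lam +
      ∑ nu ∈ smallDiagrams M, sp x nu * ∑ rho ∈ stripRemovals nu r,
        (-1) ^ height nu rho * skewSchurExt y lam.transpose rho.transpose := by
  rw [spo_eq_sum_smallDiagrams x y (by omega : lam.card ≤ M), Finset.mul_sum,
    ← Finset.sum_add_distrib]
  rw [Finset.sum_congr rfl fun eta he => by
    rw [spo_eq_sum_smallDiagrams x y
      ((mem_stripAdditions.1 he).card_eq_add.le.trans h), Finset.mul_sum]]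
  rw [Finset.sum_comm]
  refine Finset.sum_congr rfl fun nu _ => ?_
  have := congrArg (fun t => sp x nu * t) (sum_stripAdditions_conjugate y hr lam nu)
  simp only [Finset.mul_sum (s := stripAdditions lam r), mul_add] at this
  rw [mul_left_comm, ← this]
  refine Finset.sum_congr rfl fun eta _ => ?_
  ring

theorem sum_stripRemovals_spo (x : Fin n → K) (y : Fin m → K) {r : ℕ} (hr : 1 ≤ r)
    {lam : YoungDiagram} {M : ℕ} (h : lam.card ≤ M) :
    ∑ xi ∈ stripRemovals lam r, (-1) ^ height lam xi * spo x y xi =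
      ∑ nu ∈ smallDiagrams M, sp x nu * ∑ rho ∈ stripAdditions nu r,
        (-1) ^ height rho nu * skewSchurExt y lam.transpose rho.transpose := by
  rw [Finset.sum_congr rfl fun xi he => by
    rw [spo_eq_sum_smallDiagrams x y
      ((Finset.card_le_card (mem_stripRemovals.1 he).le).trans h), Finset.mul_sum]]
  rw [Finset.sum_comm]
  refine Finset.sum_congr rfl fun nu _ => ?_
  rw [← sum_stripRemovals_conjugate y hr lam nu, Finset.mul_sum]
  refine Finset.sum_congr rfl fun eta _ => ?_
  ring

/-- Summation by parts: pairs whose difference is a strip may be indexed from either end. The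
vanishing of G outside λ removes the constraint on the smaller partition. -/
theorem sum_subdiagrams_stripAdditions (f G : YoungDiagram → K) {r : ℕ} {lam : YoungDiagram}
    {M : ℕ} (h : lam.card + r ≤ M) (hG : ∀ mu, ¬ mu ≤ lam → G mu = 0) :
    ∑ mu ∈ subdiagrams lam, (∑ eta ∈ stripAdditions mu r, (-1) ^ height eta mu * f eta) * G mu =
      ∑ nu ∈ smallDiagrams M, f nu * ∑ rho ∈ stripRemovals nu r,
        (-1) ^ height nu rho * G rho := by
  have h1 : ∀ mu ∈ subdiagrams lam, (∑ eta ∈ stripAdditions mu r, (-1) ^ height eta mu * f eta) *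
      G mu = (∑ eta ∈ smallDiagrams M, stripSign K r eta mu * f eta) * G mu := by
    intro mu hmu
    have hc : mu.card ≤ lam.card := Finset.card_le_card (mem_subdiagrams.1 hmu)
    rw [sum_stripAdditions_eq (by omega : mu.card + r ≤ M)]
  rw [Finset.sum_congr rfl h1, sum_subdiagrams_eq (by omega : lam.card ≤ M) _
    fun mu hmu => by rw [hG mu hmu, mul_zero]]
  have h2 : ∀ nu ∈ smallDiagrams M,
      f nu * ∑ rho ∈ stripRemovals nu r, (-1) ^ height nu rho * G rho =
        ∑ rho ∈ smallDiagrams M, f nu * (stripSign K r nu rho * G rho) := by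
    intro nu hnu
    rw [sum_stripRemovals_eq (mem_smallDiagrams.1 hnu), Finset.mul_sum]
  rw [Finset.sum_congr rfl h2]
  simp only [Finset.sum_mul]
  rw [Finset.sum_comm]
  refine Finset.sum_congr rfl fun nu _ => Finset.sum_congr rfl fun mu _ => ?_
  ring

theorem sum_subdiagrams_stripRemovals (f G : YoungDiagram → K) {r : ℕ} {lam : YoungDiagram}
    {M : ℕ} (h : lam.card ≤ M) (hG : ∀ mu, ¬ mu ≤ lam → G mu = 0) :
    ∑ mu ∈ subdiagrams lam, (∑ xi ∈ stripRemovals mu r, (-1) ^ height mu xi * f xi) * G mu =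
      ∑ nu ∈ smallDiagrams M, f nu * ∑ rho ∈ stripAdditions nu r,
        (-1) ^ height rho nu * G rho := by
  have h1 : ∀ mu ∈ subdiagrams lam, (∑ xi ∈ stripRemovals mu r, (-1) ^ height mu xi * f xi) *
      G mu = (∑ xi ∈ smallDiagrams M, stripSign K r mu xi * f xi) * G mu := by
    intro mu hmu
    have hc : mu.card ≤ lam.card := Finset.card_le_card (mem_subdiagrams.1 hmu)
    rw [sum_stripRemovals_eq (by omega : mu.card ≤ M)]
  rw [Finset.sum_congr rfl h1, sum_subdiagrams_eq (by omega : lam.card ≤ M + r) _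
    fun mu hmu => by rw [hG mu hmu, mul_zero]]
  rw [Finset.sum_congr (s₁ := smallDiagrams M) rfl fun nu hnu => by
    rw [sum_stripAdditions_eq (Nat.add_le_add_right (mem_smallDiagrams.1 hnu) r),
      Finset.mul_sum]]
  simp only [Finset.sum_mul]
  rw [Finset.sum_comm]
  refine Finset.sum_congr rfl fun nu _ => Finset.sum_congr rfl fun mu _ => ?_
  ring

theorem superPowerSum_elim (r : ℕ) (x x' : Fin n → K) (y : Fin m → K) :
    superPowerSum r (Sum.elim x x') y =
      ∑ i, (x i ^ r + x' i ^ r) + (-1) ^ (r - 1) * ∑ j, y j ^ r := by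
  simp [superPowerSum, Fintype.sum_sum_type, Finset.sum_add_distrib]

/-- If μ_n + 1 ≥ r, every entry of μ + δ is at least r and the inner sum is empty, so the
restriction on μ may be dropped. -/
theorem third_term_filter {r : ℕ} (x : Fin (n + 1) → K) (y : Fin m → K) (lam : YoungDiagram) :
    ∑ mu ∈ (subdiagrams lam).filter (fun mu => mu.rowLen (n + 1 - 1) + 1 < r),
        (∑ q ∈ Finset.univ.filter (fun q : Fin (n + 1) => mIndex (n + 1) r mu < q.val + 1),
            (-1) ^ ((pIndex r mu q : ℤ) - (q : ℤ) + 1) * spMuQ x r mu q)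
          * skewSchur y lam.transpose mu.transpose =
      ∑ mu ∈ subdiagrams lam,
        (∑ q ∈ Finset.univ.filter (fun q : Fin (n + 1) => mIndex (n + 1) r mu < q.val + 1),
            (-1) ^ ((pIndex r mu q : ℤ) - (q : ℤ) + 1) * spMuQ x r mu q)
          * skewSchurExt y lam.transpose mu.transpose := by
  rw [Finset.sum_filter]
  refine Finset.sum_congr rfl fun mu hmu => ?_
  rw [skewSchurExt, if_pos (YoungDiagram.transpose_le_iff.2 (mem_subdiagrams.1 hmu))]
  split_ifs with h
  · rfl
  · rw [Finset.sum_eq_zero, zero_mul]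
    intro q hq
    have h1 := (mIndex_lt_iff mu q).1 (Finset.mem_filter.1 hq).2
    have h2 := mu.rowLen_anti q n (Nat.lt_succ_iff.1 q.isLt)
    have h3 := q.isLt
    simp only [shifted, delta] at h1
    simp only [Nat.add_sub_cancel] at h
    omega

/-- The orthosymplectic Murnaghan–Nakayama rule, at elements of a field. -/
theorem superPowerSum_mul_spo {r : ℕ} (hr : 1 ≤ r) {x : Fin (n + 1) → K} (hx : ∀ i, x i ≠ 0)
    (y : Fin m → K) {lam : YoungDiagram} (hlam : lam.colLen 0 ≤ n + 1) :
    superPowerSum r (Sum.elim x fun i => (x i)⁻¹) y * spo x y lam =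
      (∑ eta ∈ stripAdditions lam r, (-1) ^ height eta lam * spo x y eta)
      + (∑ xi ∈ stripRemovals lam r, (-1) ^ height lam xi * spo x y xi)
      + ∑ mu ∈ subdiagrams lam,
          (∑ q ∈ Finset.univ.filter (fun q : Fin (n + 1) => mIndex (n + 1) r mu < q.val + 1),
            (-1) ^ ((pIndex r mu q : ℤ) - (q : ℤ) + 1) * spMuQ x r mu q)
          * skewSchurExt y lam.transpose mu.transpose := by
  have hG : ∀ mu, ¬ mu ≤ lam → skewSchurExt y lam.transpose mu.transpose = 0 := fun mu hmu =>
    skewSchurExt_eq_zero y fun hh => hmu (YoungDiagram.transpose_le_iff.1 hh)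
  have hlen : ∀ mu ∈ subdiagrams lam, mu.colLen 0 ≤ n + 1 := fun mu hmu =>
    colLen_le_iff.2 (Nat.le_zero.1 ((le_iff_rowLen.1 (mem_subdiagrams.1 hmu) (n + 1)).trans
      (colLen_le_iff.1 hlam).le))
  rw [sum_stripAdditions_spo x y hr le_rfl, sum_stripRemovals_spo x y hr le_rfl,
    ← sum_subdiagrams_stripAdditions (sp x)
      (fun mu => skewSchurExt y lam.transpose mu.transpose) le_rfl hG,
    ← sum_subdiagrams_stripRemovals (sp x)
      (fun mu => skewSchurExt y lam.transpose mu.transpose) le_rfl hG,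
    superPowerSum_elim, add_mul, add_comm, add_assoc, add_assoc, ← Finset.sum_add_distrib,
    ← Finset.sum_add_distrib]
  -- The multiples of `spo` by the power sum of Y agree on both sides; what is left is an identity
  -- for each μ ⊂ λ.
  congr 1
  rw [spo_eq_sum_smallDiagrams x y le_rfl, ← sum_subdiagrams_eq le_rfl _ fun mu hmu => by
    rw [hG mu hmu, mul_zero], Finset.mul_sum]
  refine Finset.sum_congr rfl fun mu hmu => ?_
  rw [← mul_assoc, powerSum_mul_sp hr hx (hlen mu hmu), add_mul, add_mul, add_assoc]

end Orthosymplectic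

end OrthosymplecticMN
open OrthosymplecticMN
theorem theorem4p3 (n m : ℕ) (hn : 1 ≤ n) (r : ℕ) (hr : 1 ≤ r)
    (lam : YoungDiagram) (hlam : lam.colLen 0 ≤ n) :
    superPowerSum r (Sum.elim (X n m) (Xbar n m)) (Y n m) * spo (X n m) (Y n m) lam =
      (∑ eta ∈ stripAdditions lam r, (-1) ^ height eta lam * spo (X n m) (Y n m) eta)
      + (∑ xi ∈ stripRemovals lam r, (-1) ^ height lam xi * spo (X n m) (Y n m) xi)
      + ∑ mu ∈ (subdiagrams lam).filter (fun mu => mu.rowLen (n - 1) + 1 < r),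
          (∑ q ∈ Finset.univ.filter (fun q : Fin n => mIndex n r mu < q.val + 1),
              (-1) ^ ((pIndex r mu q : ℤ) - (q : ℤ) + 1) * spMuQ (X n m) r mu q)
            * skewSchur (Y n m) lam.transpose mu.transpose := by
  obtain ⟨k, rfl⟩ : ∃ k, n = k + 1 := ⟨n - 1, by omega⟩
  have hx : ∀ i, X (k + 1) m i ≠ 0 := fun i h =>
    MvPolynomial.X_ne_zero (R := ℤ) (Sum.inl i : Fin (k + 1) ⊕ Fin m)
      (IsFractionRing.injective _ (RatFun (k + 1) m) (h.trans (map_zero _).symm))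
  rw [third_term_filter]
  exact superPowerSum_mul_spo hr hx (Y (k + 1) m) hlam
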